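/- **Setting.** Let $n\ge 1$, and let $\{1,\dots,p\}$ be partitioned into $m$ disjoint groups $G_1,\dots,G_m$ of $d$ variables each. Let $s,s_0$ be integers with $1\le s\le m$ and $1\le s_0\le d$. Consider $y=X\beta^*+\xi$ with a fixed design $X\in\mathbb{R}^{n\times p}$ and noise $\xi$ with independent $\mathcal N(0,\sigma^2)$ entries, $\sigma>0$. Write $\|v\|_n^2=\frac1n\sum_{i=1}^n v_i^2$, $\|\beta\|_1=\sum_i|\beta_i|$ and $\|\beta\|_{1,2}=\sum_{j=1}^m\|\beta_{G_j}\|_2$. The vector $\beta$ is called $(s,s_0)$-sparse if at most $s$ of the vectors $\beta_{G_j}$ are nonzero and at most $ss_0$ of the coordinates $\beta_i$ are nonzero. For $c_0>0$ let $$\theta(s,s_0,c_0)=\min\Big\{\tfrac{\|X\delta\|_n}{\|\delta\|_2}\;:\;\delta\ne 0,\ \|\delta\|_1+\sqrt{s_0}\,\|\delta\|_{1,2}\le(2+c_0)\sqrt{ss_0}\,\|\delta\|_2\Big\}.$$ For $\gamma\in(0,1)$ let $$\lambda^{\#}=\frac{(4+\sqrt2)\sigma}{\gamma\sqrt n}\sqrt{\log\frac{2ed}{s_0}+\frac{2}{s_0}\log\frac{4em}{s}},\qquad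 \delta(\lambda)=\exp\Big(-\Big(\frac{\gamma\lambda\sqrt n}{(4+\sqrt2)\sigma}\Big)^2\Big),$$ and let a sparse group Lasso estimator $\hat\beta$ be any minimizer over $\beta\in\mathbb R^p$ of $$\|y-X\beta\|_n^2+2\lambda^{\#}\big(\|\beta\|_1+\sqrt{s_0}\,\|\beta\|_{1,2}\big).$$ **Theorem.** Assume that $\beta^*$ is $(s,s_0)$-sparse; that the sparse group normalization condition holds, i.e. the submatrix $X_S$ of columns of $X$ indexed by $S$ has spectral norm at most $\sqrt n$ whenever $|S|=s_0$ and $S\subseteq G_j$ for some $j$; and that the strong sparse group restricted eigenvalue (SSGRE) condition $\theta:=\theta\big(s,s_0,\tfrac{2(1+\gamma)}{1-\gamma}\big)>0$ holds. Then $\hat\beta$ exists for every realization of the noise, and for every $\delta_0\in(0,1)$, with probability at least $1-\delta_0/2$, every such $\hat\beta$ satisfies $$\|\hat\beta-\beta^*\|_2\le(1+\gamma)\sqrt{ss_0}\,\lambda^{\#}\max\Big\{\frac{2}{\theta^2},\ \frac12\cdot\frac{\log(1/\delta_0)}{\log(1/\delta(\lambda^{\#}))\,ss_0}\Big\}.$$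 In particular, for every $C>0$, with probability at least $1-\frac12\exp\{-C(ss_0\log\frac{2ed}{s_0}+2s\log\frac{4em}{s})\}$, every such $\hat\beta$ satisfies $$\|\hat\beta-\beta^*\|_2\le 12\,\frac{1+\gamma}{\gamma}\max\Big\{\frac2{\theta^2},\frac C2\Big\}\cdot\frac{\sigma\sqrt{ss_0\log(ed/s_0)+s\log(em/s)}}{\sqrt n}.$$ -/

import Mathlib

open MeasureTheory ProbabilityTheory

namespace SGLasso

/-- The Euclidean norm `‖v‖₂` of a finite real vector. -/
noncomputable def l2norm {ι : Type*} [Fintype ι] (v : ι → ℝ) : ℝ := ‖WithLp.toLp 2 v‖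

/-- The norm `‖v‖₁ = ∑ i, |v i|`. -/
def l1norm {ι : Type*} [Fintype ι] (v : ι → ℝ) : ℝ := ∑ i, |v i|

/-- The empirical norm `‖v‖ₙ`, with `‖v‖ₙ² = (1/n) ∑ i, (v i)²`. -/
noncomputable def empNorm {n : ℕ} (v : Fin n → ℝ) : ℝ := √((1 / (n : ℝ)) * ∑ i, v i ^ 2)

/-- `G 0, …, G (m-1)` are disjoint groups of `d` variables each, with union the set of all `p`
variables. -/
structure IsGrouping {p m : ℕ} (G : Fin m → Finset (Fin p)) (d : ℕ) : Prop where
  disjoint : ∀ j k, j ≠ k → Disjoint (G j) (G k)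
  cover : ∀ i, ∃ j, i ∈ G j
  card : ∀ j, (G j).card = d

/-- The group norm `‖β‖_{1,2} = ∑ j, ‖β_{G_j}‖₂`. -/
noncomputable def groupNorm {p m : ℕ} (G : Fin m → Finset (Fin p)) (β : Fin p → ℝ) : ℝ :=
  ∑ j, l2norm (fun i : G j => β i)

/-- `β` is `(s, s₀)`-sparse: at most `s` groups are active, and at most `s * s₀` coordinates are
nonzero. -/
def IsDoubleSparse {p m : ℕ} (G : Fin m → Finset (Fin p)) (s s₀ : ℕ) (β : Fin p → ℝ) : Prop :=
  (Finset.univ.filter fun j => ∃ i ∈ G j, β i ≠ 0).card ≤ s ∧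
    (Finset.univ.filter fun i => β i ≠ 0).card ≤ s * s₀

open scoped Matrix.Norms.L2Operator in
/-- Sparse group normalization: the spectral norm of `X_S` is at most `√n` for every set `S` of
`s₀` columns contained in one group. -/
def SparseGroupNormalized {n p m : ℕ} (X : Matrix (Fin n) (Fin p) ℝ)
    (G : Fin m → Finset (Fin p)) (s₀ : ℕ) : Prop :=
  ∀ j, ∀ S : Finset (Fin p), S ⊆ G j → S.card = s₀ →
    ‖X.submatrix id (fun i : S => (i : Fin p))‖ ≤ √(n : ℝ)

/-- The cone of all `δ` with `‖δ‖₁ + √s₀ ‖δ‖_{1,2} ≤ (2 + c₀) √(s s₀) ‖δ‖₂`. -/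
def ssgreCone {p m : ℕ} (G : Fin m → Finset (Fin p)) (s s₀ : ℕ) (c₀ : ℝ) : Set (Fin p → ℝ) :=
  {δ | l1norm δ + √(s₀ : ℝ) * groupNorm G δ ≤ (2 + c₀) * √((s : ℝ) * s₀) * l2norm δ}

/-- The restricted eigenvalue `θ(s, s₀, c₀)`: the least value of `‖X δ‖ₙ / ‖δ‖₂` over the nonzero
`δ` of the cone. -/
noncomputable def ssgreConst {n p m : ℕ} (X : Matrix (Fin n) (Fin p) ℝ)
    (G : Fin m → Finset (Fin p)) (s s₀ : ℕ) (c₀ : ℝ) : ℝ :=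
  sInf ((fun δ => empNorm (X.mulVec δ) / l2norm δ) '' (ssgreCone G s s₀ c₀ \ {0}))

/-- The tuning parameter `λ^#`. -/
noncomputable def tuning (γ σ : ℝ) (n m d s s₀ : ℕ) : ℝ :=
  (4 + √2) * σ / (γ * √(n : ℝ)) *
    √(Real.log (2 * Real.exp 1 * d / s₀) + 2 / s₀ * Real.log (4 * Real.exp 1 * m / s))

/-- `δ(λ) = exp (-(γ λ √n / ((4 + √2) σ))²)`. -/
noncomputable def deltaOf (γ σ : ℝ) (n : ℕ) (lam : ℝ) : ℝ :=
  Real.exp (-(γ * lam * √(n : ℝ) / ((4 + √2) * σ)) ^ 2)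

/-- The sparse group Lasso objective
`‖y - X β‖ₙ² + 2 λ (‖β‖₁ + √s₀ ‖β‖_{1,2})`. -/
noncomputable def objective {n p m : ℕ} (X : Matrix (Fin n) (Fin p) ℝ)
    (G : Fin m → Finset (Fin p)) (s₀ : ℕ) (lam : ℝ) (y : Fin n → ℝ) (β : Fin p → ℝ) : ℝ :=
  empNorm (y - X.mulVec β) ^ 2 + 2 * lam * (l1norm β + √(s₀ : ℝ) * groupNorm G β)

/-- `b` is a solution of the sparse group Lasso problem with data `y`. -/
def IsSolution {n p m : ℕ} (X : Matrix (Fin n) (Fin p) ℝ)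
    (G : Fin m → Finset (Fin p)) (s₀ : ℕ) (lam : ℝ) (y : Fin n → ℝ) (b : Fin p → ℝ) : Prop :=
  ∀ β, objective X G s₀ lam y b ≤ objective X G s₀ lam y β

end SGLasso

open SGLasso

open MeasureTheory ProbabilityTheory

/-! Write `u` for the error of the estimator, `w = ‖u‖₂`, `κ = √(s s₀)`, and `L` for `logRate`,
which equals `log (1 / δ(λ^#))`. First-order optimality bounds `‖X u‖ₙ²` by a noise term linear in
`u` plus `λ` times the drop of the penalty from the truth to the estimator. Double sparsity bounds
this drop both by `2κw` and by `4κw` minus the penalty of `u`. It remains to bound the noise term,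
uniformly in `u`, by `γλ` times the largest of the penalty of `u`, `2κw` and `ρ‖X u‖ₙ`, with `ρ² =
log (1/δ₀) / L`. If one of the first two dominates, `u` lies in the cone and the restricted
eigenvalue yields the term `2/θ²`. If the third dominates, `w` is controlled by `‖X u‖ₙ` directly,
and the confidence term results (`IsSolution.l2norm_sub_le`). Since `δ₀` enters only through `ρ`,
the tuning parameter does not depend on it.

The noise bound has two stages. A bound by the first two terms alone holds with probability at least
`1/2` (`half_le_measure_penaltyBoundSet`): soft-threshold the score at `2√L`; what survives is paid
for by the excess energy of blocks of `s₀` coordinates, whose expectation is small by Gaussian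
exponential moments and a count of blocks. Then Gaussian concentration in Maurey's form, a
tensorized consequence of the Prékopa–Leindler inequality, upgrades probability `1/2` to `1 - δ₀/2`
at the price of the third term (`measure_compl_scoreBoundSet_mul_le`). The noise need only move a
distance proportional to the deviation, and a move changes the score in direction `u` by at most its
length times `‖X u‖ₙ`. -/

namespace SGLasso

/-! ### Prékopa–Leindler on the line -/

open scoped ENNReal Pointwise

/-- Brunn–Minkowski on the line: for compact sets, the translate of the first by the minimum of the
second and of the second by the maximum of the first both lie in the sumset and meet only at one
point. Inner regularity does the rest. -/
theorem volume_add_volume_le {A B C : Set ℝ} (hA : MeasurableSet A) (hB : MeasurableSet B)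
    (hAne : A.Nonempty) (hBne : B.Nonempty) (h : ∀ x ∈ A, ∀ y ∈ B, x + y ∈ C) :
    volume A + volume B ≤ volume C := by
  have compact_case : ∀ K₁ ⊆ A, ∀ K₂ ⊆ B, IsCompact K₁ → IsCompact K₂ → K₁.Nonempty →
      K₂.Nonempty → volume K₁ + volume K₂ ≤ volume C := by
    intro K₁ h₁ K₂ h₂ c₁ c₂ n₁ n₂
    have m₁ := c₁.sSup_mem n₁
    have m₂ := c₂.sInf_mem n₂
    set a := sSup K₁
    set b := sInf K₂
    have e₁ : volume ((fun x => x + b) '' K₁) = volume K₁ := by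
      simp [Set.image_add_right]
    have e₂ : volume ((fun x => a + x) '' K₂) = volume K₂ := by
      simp [Set.image_add_left]
    have c₁' : MeasurableSet ((fun x => x + b) '' K₁) :=
      (c₁.image (by fun_prop)).measurableSet
    have hd : AEDisjoint volume ((fun x => x + b) '' K₁) ((fun x => a + x) '' K₂) := by
      refine measure_mono_null (t := {a + b}) ?_ (by simp)
      rintro _ ⟨⟨x, hx, rfl⟩, ⟨y, hy, hxy⟩⟩
      have h1 : x ≤ a := le_csSup c₁.bddAbove hx
      have h2 : b ≤ y := csInf_le c₂.bddBelow hy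
      simp only at hxy ⊢
      rw [Set.mem_singleton_iff]
      linarith
    rw [← e₁, ← e₂, ← measure_union₀' c₁'.nullMeasurableSet hd]
    refine measure_mono ?_
    rintro _ (⟨x, hx, rfl⟩ | ⟨y, hy, rfl⟩)
    · exact h x (h₁ hx) b (h₂ m₂)
    · exact h a (h₁ m₁) y (h₂ hy)
  obtain ⟨a, ha⟩ := hAne
  obtain ⟨b, hb⟩ := hBne
  have approx : ∀ {S : Set ℝ} {c : ℝ}, MeasurableSet S → c ∈ S → volume S =
      ⨆ K : {K : Set ℝ // K ⊆ S ∧ IsCompact K ∧ K.Nonempty}, volume (K : Set ℝ) := by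
    intro S c hS hc
    refine le_antisymm ?_ (iSup_le fun K => measure_mono K.2.1)
    rw [hS.measure_eq_iSup_isCompact]
    refine iSup₂_le fun K hK => iSup_le fun hKc => ?_
    -- Adjoining `c` makes the approximating compact set nonempty, as the compact case requires.
    exact (measure_mono (Set.subset_insert c K)).trans (le_iSup
      (fun K : {K : Set ℝ // K ⊆ S ∧ IsCompact K ∧ K.Nonempty} => volume (K : Set ℝ))
      ⟨insert c K, Set.insert_subset hc hK, hKc.insert c, by simp⟩)
  have : Nonempty {K : Set ℝ // K ⊆ A ∧ IsCompact K ∧ K.Nonempty} :=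
    ⟨{a}, by simpa using ha, isCompact_singleton, by simp⟩
  have : Nonempty {K : Set ℝ // K ⊆ B ∧ IsCompact K ∧ K.Nonempty} :=
    ⟨{b}, by simpa using hb, isCompact_singleton, by simp⟩
  rw [approx hA ha, approx hB hb]
  exact ENNReal.iSup_add_iSup_le fun K₁ K₂ =>
    compact_case K₁ K₁.2.1 K₂ K₂.2.1 K₁.2.2.1 K₂.2.2.1 K₁.2.2.2 K₂.2.2.2

/-- Layer cake: the superlevel sets at each height satisfy the one-dimensional Brunn–Minkowski
inequality. The condition `hsup` is needed because that inequality fails when exactly one of the two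
sets is empty. -/
theorem add_lintegral_le_of_sup_eq {f g h : ℝ → ℝ} (hf : Measurable f) (hg : Measurable g)
    (hh : Measurable h) (hf0 : ∀ x, 0 ≤ f x) (hg0 : ∀ x, 0 ≤ g x) (hh0 : ∀ x, 0 ≤ h x)
    (hfg : ∀ x y, f x * g y ≤ h ((x + y) / 2) ^ 2)
    (hsup : ∀ t, 0 < t → ((∃ x, t < f x) ↔ ∃ y, t < g y)) :
    (∫⁻ x, ENNReal.ofReal (f x)) + ∫⁻ x, ENNReal.ofReal (g x) ≤
      2 * ∫⁻ x, ENNReal.ofReal (h x) := by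
  rw [lintegral_eq_lintegral_meas_lt _ (ae_of_all _ hf0) hf.aemeasurable,
    lintegral_eq_lintegral_meas_lt _ (ae_of_all _ hg0) hg.aemeasurable,
    lintegral_eq_lintegral_meas_lt _ (ae_of_all _ hh0) hh.aemeasurable]
  have hm : Measurable fun t : ℝ => volume {x | t < f x} :=
    Antitone.measurable fun s t hst => measure_mono fun x (hx : t < f x) => lt_of_le_of_lt hst hx
  rw [← lintegral_add_left hm, ← lintegral_const_mul']
  swap; · simp
  refine setLIntegral_mono' measurableSet_Ioi fun t (ht : 0 < t) => ?_
  by_cases hne : ∃ x, t < f x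
  · have key := volume_add_volume_le (A := {x | t < f x}) (B := {x | t < g x})
      (C := (2 : ℝ) • {x | t < h x}) (measurableSet_lt measurable_const hf)
      (measurableSet_lt measurable_const hg) hne ((hsup t ht).1 hne) ?_
    · rwa [Measure.addHaar_smul, Module.finrank_self, pow_one, abs_of_pos two_pos,
        ENNReal.ofReal_ofNat] at key
    · intro x (hx : t < f x) y (hy : t < g y)
      refine ⟨(x + y) / 2, ?_, by simp only [smul_eq_mul]; ring⟩
      have := hfg x y
      have : t ^ 2 < h ((x + y) / 2) ^ 2 := by nlinarith
      exact lt_of_pow_lt_pow_left₀ 2 (hh0 _) this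
  · have h1 : {x | t < f x} = ∅ := Set.eq_empty_of_forall_notMem fun x hx => hne ⟨x, hx⟩
    have h2 : {x | t < g x} = ∅ :=
      Set.eq_empty_of_forall_notMem fun x hx => hne ((hsup t ht).2 ⟨x, hx⟩)
    simp [h1, h2]

/-- The Prékopa–Leindler inequality on the line for the midpoint, with bounded `h`. -/
theorem lintegral_mul_lintegral_le_sq {f g h : ℝ → ℝ≥0∞} (hf : Measurable f) (hg : Measurable g)
    (hh : Measurable h) (M : ℝ≥0∞) (hM : M ≠ ⊤) (hhM : ∀ x, h x ≤ M)
    (hfg : ∀ x y, f x * g y ≤ h ((x + y) / 2) ^ 2) :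
    (∫⁻ x, f x) * ∫⁻ x, g x ≤ (∫⁻ x, h x) ^ 2 := by
  set a := ⨆ x, f x with ha
  set b := ⨆ x, g x with hb
  have hfa : ∀ x, f x ≤ a := le_iSup f
  have hgb : ∀ x, g x ≤ b := le_iSup g
  -- Boundedness of `h` makes both suprema finite, so `f` and `g` can be normalized to have supremum
  -- `1`.
  have hab : a * b ≤ M ^ 2 := by
    rw [ha, ENNReal.iSup_mul]
    refine iSup_le fun x => ?_
    rw [hb, ENNReal.mul_iSup]
    exact iSup_le fun y => (hfg x y).trans (by gcongr; exact hhM _)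
  by_cases ha0 : a = 0
  · have : ∀ x, f x = 0 := fun x => le_antisymm (ha0 ▸ hfa x) bot_le
    simp [this]
  by_cases hb0 : b = 0
  · have : ∀ x, g x = 0 := fun x => le_antisymm (hb0 ▸ hgb x) bot_le
    simp [this]
  have habt : a * b ≠ ⊤ := ne_top_of_le_ne_top (by finiteness) hab
  have hat : a ≠ ⊤ := fun h => habt (by rw [h, ENNReal.top_mul hb0])
  have hbt : b ≠ ⊤ := fun h => habt (by rw [h, ENNReal.mul_top ha0])
  have hft : ∀ x, f x ≠ ⊤ := fun x => ne_top_of_le_ne_top hat (hfa x)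
  have hgt : ∀ x, g x ≠ ⊤ := fun x => ne_top_of_le_ne_top hbt (hgb x)
  have hht : ∀ x, h x ≠ ⊤ := fun x => ne_top_of_le_ne_top hM (hhM x)
  set α := a.toReal with hα
  set β := b.toReal with hβ
  have hα0 : 0 < α := ENNReal.toReal_pos ha0 hat
  have hβ0 : 0 < β := ENNReal.toReal_pos hb0 hbt
  have hsf : ∀ t, 0 < t → ((∃ x, t < (f x).toReal / α) ↔ t < 1) := by
    intro t ht
    constructor
    · rintro ⟨x, hx⟩
      refine hx.trans_le ((div_le_one hα0).2 ?_)
      exact ENNReal.toReal_mono hat (hfa x)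
    · intro h1
      have : ENNReal.ofReal (t * α) < ⨆ x, f x := by
        rw [← ha, ENNReal.ofReal_lt_iff_lt_toReal (by positivity) hat]
        nlinarith
      obtain ⟨x, hx⟩ := lt_iSup_iff.1 this
      exact ⟨x, by rwa [lt_div_iff₀ hα0, ← ENNReal.ofReal_lt_iff_lt_toReal (by positivity) (hft x)]⟩
  have hsg : ∀ t, 0 < t → ((∃ x, t < (g x).toReal / β) ↔ t < 1) := by
    intro t ht
    constructor
    · rintro ⟨x, hx⟩
      refine hx.trans_le ((div_le_one hβ0).2 ?_)
      exact ENNReal.toReal_mono hbt (hgb x)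
    · intro h1
      have : ENNReal.ofReal (t * β) < ⨆ x, g x := by
        rw [← hb, ENNReal.ofReal_lt_iff_lt_toReal (by positivity) hbt]
        nlinarith
      obtain ⟨x, hx⟩ := lt_iSup_iff.1 this
      exact ⟨x, by rwa [lt_div_iff₀ hβ0, ← ENNReal.ofReal_lt_iff_lt_toReal (by positivity) (hgt x)]⟩
  have key := add_lintegral_le_of_sup_eq (f := fun x => (f x).toReal / α)
    (g := fun x => (g x).toReal / β) (h := fun x => (h x).toReal / √(α * β))
    (by fun_prop) (by fun_prop) (by fun_prop) (fun x => by positivity) (fun x => by positivity)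
    (fun x => by positivity) ?_ (fun t ht => (hsf t ht).trans (hsg t ht).symm)
  swap
  · intro x y
    rw [div_mul_div_comm, div_pow, Real.sq_sqrt (by positivity)]
    gcongr
    rw [← ENNReal.toReal_mul, ← ENNReal.toReal_pow]
    exact ENNReal.toReal_mono (by simp [hht]) (hfg x y)
  have e : ∀ (k : ℝ → ℝ≥0∞) (c : ℝ), (∀ x, k x ≠ ⊤) → 0 < c →
      ∫⁻ x, ENNReal.ofReal ((k x).toReal / c) = (∫⁻ x, k x) / ENNReal.ofReal c := by
    intro k c hk hc
    rw [div_eq_mul_inv, ← lintegral_mul_const']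
    · refine lintegral_congr fun x => ?_
      rw [ENNReal.ofReal_div_of_pos hc, ENNReal.ofReal_toReal (hk x), div_eq_mul_inv]
    · simp [hc]
  rw [e f α hft hα0, e g β hgt hβ0, e h _ hht (by positivity)] at key
  by_cases hH : ∫⁻ x, h x = ⊤
  · simp [hH]
  have hne : ∀ c : ℝ, 0 < c → ENNReal.ofReal c ≠ 0 := fun c hc => by simp [hc]
  have hF : ∫⁻ x, f x ≠ ⊤ := by
    intro hF
    rw [hF, ENNReal.top_div_of_ne_top (by simp), top_add, top_le_iff] at key
    exact (ENNReal.mul_ne_top (by simp) (ENNReal.div_ne_top hH (hne _ (by positivity)))) key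
  have hG : ∫⁻ x, g x ≠ ⊤ := by
    intro hG
    rw [hG, ENNReal.top_div_of_ne_top (by simp), add_top, top_le_iff] at key
    exact (ENNReal.mul_ne_top (by simp) (ENNReal.div_ne_top hH (hne _ (by positivity)))) key
  lift (∫⁻ x, f x) to NNReal using hF with F
  lift (∫⁻ x, g x) to NNReal using hG with G
  lift (∫⁻ x, h x) to NNReal using hH with H
  have k2 := ENNReal.toReal_mono (by
    exact (ENNReal.mul_ne_top (by simp) (ENNReal.div_ne_top (by simp) (hne _ (by positivity)))))
    key
  rw [ENNReal.toReal_add (ENNReal.div_ne_top (by simp) (hne _ hα0))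
    (ENNReal.div_ne_top (by simp) (hne _ hβ0))] at k2
  simp only [ENNReal.toReal_div, ENNReal.coe_toReal, ENNReal.toReal_mul, ENNReal.toReal_ofNat,
    ENNReal.toReal_ofReal hα0.le, ENNReal.toReal_ofReal hβ0.le,
    ENNReal.toReal_ofReal (Real.sqrt_nonneg _)] at k2
  norm_cast
  rw [← NNReal.coe_le_coe]
  push_cast
  -- AM–GM turns the additive inequality for the normalized functions into the multiplicative one;
  -- the normalizing constants then cancel.
  have k3 : (F : ℝ) / α * (G / β) ≤ (H / √(α * β)) ^ 2 := by
    have h1 : 0 ≤ (F : ℝ) / α + G / β := by positivity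
    nlinarith [sq_nonneg ((F : ℝ) / α - G / β), mul_self_le_mul_self h1 k2]
  rw [div_mul_div_comm, div_pow, Real.sq_sqrt (by positivity)] at k3
  exact (div_le_div_iff_of_pos_right (by positivity)).1 k3

/-! ### Property (τ) of the Gaussian measure -/

/-- With `φ` the Gaussian density, `φ(x) φ(y) exp((x - y)²/4) = φ((x + y)/2)²` by the parallelogram
identity, so Prékopa–Leindler applies with `h = φ`. -/
theorem lintegral_mul_lintegral_gaussianReal_le_one {u v : ℝ → ℝ≥0∞} (hu : Measurable u)
    (hv : Measurable v) (huv : ∀ x y, u x * v y ≤ ENNReal.ofReal (Real.exp ((x - y) ^ 2 / 4))) :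
    (∫⁻ x, u x ∂(gaussianReal 0 1)) * ∫⁻ x, v x ∂(gaussianReal 0 1) ≤ 1 := by
  have hφ := measurable_gaussianPDF 0 1
  have key := lintegral_mul_lintegral_le_sq (f := fun x => gaussianPDF 0 1 x * u x)
    (g := fun x => gaussianPDF 0 1 x * v x) (h := gaussianPDF 0 1) (by fun_prop) (by fun_prop)
    hφ (gaussianPDF 0 1 0) gaussianPDF_ne_top ?_ ?_
  · rw [lintegral_gaussianPDF_eq_one 0 one_ne_zero, one_pow] at key
    rw [gaussianReal_of_var_ne_zero 0 one_ne_zero,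
      lintegral_withDensity_eq_lintegral_mul _ hφ hu,
      lintegral_withDensity_eq_lintegral_mul _ hφ hv]
    exact key
  · intro x
    refine ENNReal.ofReal_le_ofReal ?_
    simp only [gaussianPDFReal]
    gcongr ?_ * Real.exp (?_ / _)
    simp only [sub_zero]
    nlinarith [sq_nonneg x]
  · intro x y
    calc gaussianPDF 0 1 x * u x * (gaussianPDF 0 1 y * v y)
        = gaussianPDF 0 1 x * gaussianPDF 0 1 y * (u x * v y) := by ring
      _ ≤ gaussianPDF 0 1 x * gaussianPDF 0 1 y * ENNReal.ofReal (Real.exp ((x - y) ^ 2 / 4)) := by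
          gcongr; exact huv x y
      _ = gaussianPDF 0 1 ((x + y) / 2) ^ 2 := by
          simp only [gaussianPDF]
          rw [← ENNReal.ofReal_mul (gaussianPDFReal_nonneg _ _ _),
            ← ENNReal.ofReal_mul (mul_nonneg (gaussianPDFReal_nonneg _ _ _)
              (gaussianPDFReal_nonneg _ _ _)),
            ← ENNReal.ofReal_pow (gaussianPDFReal_nonneg _ _ _)]
          congr 1
          simp only [gaussianPDFReal]
          rw [mul_pow, mul_mul_mul_comm, mul_assoc, ← pow_two, ← Real.exp_add, ← Real.exp_add,
            ← Real.exp_nat_mul]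
          congr 2
          simp only [NNReal.coe_one]
          push_cast
          ring

/-- Maurey's property (τ) of the standard Gaussian measure. -/
theorem lintegral_mul_lintegral_pi_gaussianReal_le_one {n : ℕ} {u v : (Fin n → ℝ) → ℝ≥0∞}
    (hu : Measurable u) (hv : Measurable v)
    (huv : ∀ x y, u x * v y ≤ ENNReal.ofReal (Real.exp ((∑ i, (x i - y i) ^ 2) / 4))) :
    (∫⁻ x, u x ∂(Measure.pi fun _ => gaussianReal 0 1)) *
      ∫⁻ x, v x ∂(Measure.pi fun _ => gaussianReal 0 1) ≤ 1 := by
  induction n with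
  | zero =>
    rw [Measure.pi_of_empty, lintegral_dirac' _ hu, lintegral_dirac' _ hv]
    simpa using huv isEmptyElim isEmptyElim
  | succ n ih =>
    have mp := (measurePreserving_piFinSuccAbove
      (fun _ : Fin (n + 1) => gaussianReal 0 1) 0).symm
    have split : ∀ w : (Fin (n + 1) → ℝ) → ℝ≥0∞, Measurable w →
        ∫⁻ x, w x ∂(Measure.pi fun _ => gaussianReal 0 1) =
          ∫⁻ a, ∫⁻ z, w (Fin.cons a z) ∂(Measure.pi fun _ => gaussianReal 0 1)
            ∂(gaussianReal 0 1) := by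
      intro w hw
      rw [← mp.lintegral_comp hw, lintegral_prod _ (by fun_prop)]
      simp [MeasurableEquiv.piFinSuccAbove_symm_apply, Fin.insertNthEquiv]
    have hcons : Measurable fun q : ℝ × (Fin n → ℝ) => (Fin.cons q.1 q.2 : Fin (n + 1) → ℝ) := by
      refine measurable_pi_lambda _ fun i => ?_
      refine Fin.cases ?_ (fun j => ?_) i
      · simpa using measurable_fst
      · simp only [Fin.cons_succ]; fun_prop
    rw [split u hu, split v hv]
    refine lintegral_mul_lintegral_gaussianReal_le_one
      (Measurable.lintegral_prod_right' (f := fun q => u (Fin.cons q.1 q.2)) (hu.comp hcons))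
      (Measurable.lintegral_prod_right' (f := fun q => v (Fin.cons q.1 q.2)) (hv.comp hcons)) ?_
    intro x y
    have hx : Measurable fun z => u (Fin.cons x z) := hu.comp (hcons.comp measurable_prodMk_left)
    have hy : Measurable fun z => v (Fin.cons y z) := hv.comp (hcons.comp measurable_prodMk_left)
    have hE : ENNReal.ofReal (Real.exp ((x - y) ^ 2 / 4)) ≠ 0 := by simp [Real.exp_pos]
    have hE' : ENNReal.ofReal (Real.exp ((x - y) ^ 2 / 4)) ≠ ⊤ := by simp
    -- With the first coordinates frozen at `x` and `y`, their share of the cost is divided out of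
    -- `u`; the section integrals then satisfy the one-dimensional hypothesis.
    have := ih (u := fun z => (ENNReal.ofReal (Real.exp ((x - y) ^ 2 / 4)))⁻¹ * u (Fin.cons x z))
      (v := fun z => v (Fin.cons y z)) (by fun_prop) hy ?_
    · rw [lintegral_const_mul _ hx, mul_assoc, ENNReal.inv_mul_le_iff hE hE', mul_one] at this
      exact this
    · intro z w
      rw [mul_assoc, ENNReal.inv_mul_le_iff hE hE', ← ENNReal.ofReal_mul (Real.exp_pos _).le,
        ← Real.exp_add]
      refine (huv _ _).trans (le_of_eq ?_)
      rw [Fin.sum_univ_succ]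
      simp only [Fin.cons_zero, Fin.cons_succ, add_div]

/-! ### Gaussian exponential moments -/

theorem lintegral_pi_ofReal_prod {ι : Type*} [Fintype ι] (μ : Measure ℝ) [SigmaFinite μ]
    {f : ι → ℝ → ℝ} (hf : ∀ i, Integrable (f i) μ) (hf0 : ∀ i x, 0 ≤ f i x) :
    ∫⁻ x, ENNReal.ofReal (∏ i, f i (x i)) ∂(Measure.pi fun _ : ι => μ) =
      ENNReal.ofReal (∏ i, ∫ x, f i x ∂μ) := by
  rw [← ofReal_integral_eq_lintegral_ofReal (Integrable.fintype_prod hf)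
    (ae_of_all _ fun x => Finset.prod_nonneg fun i _ => hf0 i _), integral_fintype_prod_eq_prod]

theorem lintegral_exp_linear_gaussian {ι : Type*} [Fintype ι] (a : ι → ℝ) :
    ∫⁻ x, ENNReal.ofReal (Real.exp (∑ i, a i * x i)) ∂(Measure.pi fun _ : ι => gaussianReal 0 1) =
      ENNReal.ofReal (Real.exp ((∑ i, a i ^ 2) / 2)) := by
  simp_rw [Real.exp_sum]
  rw [lintegral_pi_ofReal_prod (f := fun i x => Real.exp (a i * x)) _
    (fun i => integrable_exp_mul_gaussianReal _) fun i x => (Real.exp_pos _).le]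
  have : ∀ i, ∫ x, Real.exp (a i * x) ∂(gaussianReal 0 1) = Real.exp (a i ^ 2 / 2) := fun i => by
    have := congrFun (mgf_fun_id_gaussianReal (μ := 0) (v := 1)) (a i)
    simpa [mgf] using this
  simp_rw [this]
  rw [← Real.exp_sum, Finset.sum_div]

theorem gaussianPDFReal_mul_exp_quarter_sq (x : ℝ) :
    gaussianPDFReal 0 1 x * Real.exp (x ^ 2 / 4) = (√(2 * Real.pi))⁻¹ * Real.exp (-(1 / 4) * x ^ 2) := by
  simp only [gaussianPDFReal, NNReal.coe_one, mul_one, mul_assoc, ← Real.exp_add]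
  congr 2
  ring

theorem integrable_exp_quarter_sq : Integrable (fun x => Real.exp (x ^ 2 / 4)) (gaussianReal 0 1) := by
  rw [gaussianReal_of_var_ne_zero 0 one_ne_zero, integrable_withDensity_iff_integrable_smul'
    (measurable_gaussianPDF 0 1) (ae_of_all _ fun x => gaussianPDF_lt_top)]
  simp only [toReal_gaussianPDF, smul_eq_mul, gaussianPDFReal_mul_exp_quarter_sq]
  exact (integrable_exp_neg_mul_sq (by norm_num)).const_mul _

theorem integral_exp_quarter_sq : ∫ x, Real.exp (x ^ 2 / 4) ∂(gaussianReal 0 1) = √2 := by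
  rw [integral_gaussianReal_eq_integral_smul one_ne_zero]
  simp only [smul_eq_mul, gaussianPDFReal_mul_exp_quarter_sq]
  rw [integral_const_mul, integral_gaussian, ← Real.sqrt_inv, ← Real.sqrt_mul (by positivity)]
  congr 1
  have := Real.pi_pos.ne'
  field_simp
  norm_num

theorem lintegral_exp_quarter_sq_gaussian {ι : Type*} [Fintype ι] :
    ∫⁻ x, ENNReal.ofReal (Real.exp ((∑ i, x i ^ 2) / 4))
      ∂(Measure.pi fun _ : ι => gaussianReal 0 1) = ENNReal.ofReal (√2 ^ Fintype.card ι) := by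
  simp_rw [Finset.sum_div, Real.exp_sum]
  rw [lintegral_pi_ofReal_prod (f := fun i x => Real.exp (x ^ 2 / 4)) _
    (fun i => integrable_exp_quarter_sq) fun i x => (Real.exp_pos _).le]
  simp [integral_exp_quarter_sq]

open Matrix in
/-- The exponential moment of a quadratic form of a standard Gaussian vector, by linearization. -/
theorem lintegral_exp_quarter_sq_vecMul_le {ι κ : Type*} [Fintype ι] [Fintype κ]
    (B : Matrix ι κ ℝ) (hB : ∀ h : κ → ℝ, ∑ i, (B *ᵥ h) i ^ 2 ≤ ∑ k, h k ^ 2) :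
    ∫⁻ x, ENNReal.ofReal (Real.exp ((∑ k, (x ᵥ* B) k ^ 2) / 4))
      ∂(Measure.pi fun _ : ι => gaussianReal 0 1) ≤ ENNReal.ofReal (√2 ^ Fintype.card κ) := by
  -- Writes the exponential of the quadratic form as an average over an independent Gaussian `h` of
  -- exponentials linear in `x`. After Tonelli, the contraction bound on `B` can be used on `h`.
  have lin : ∀ x : ι → ℝ, ENNReal.ofReal (Real.exp ((∑ k, (x ᵥ* B) k ^ 2) / 4)) =
      ∫⁻ h, ENNReal.ofReal (Real.exp (((x ᵥ* B) ⬝ᵥ h) / √2))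
        ∂(Measure.pi fun _ : κ => gaussianReal 0 1) := by
    intro x
    have := lintegral_exp_linear_gaussian fun k => (x ᵥ* B) k / √2
    simp only [div_pow, Real.sq_sqrt zero_le_two, ← Finset.sum_div, div_mul_eq_mul_div] at this
    simp only [dotProduct, this]
    congr 2; ring
  have lin' : ∀ h : κ → ℝ, ∫⁻ x, ENNReal.ofReal (Real.exp (((x ᵥ* B) ⬝ᵥ h) / √2))
        ∂(Measure.pi fun _ : ι => gaussianReal 0 1) =
      ENNReal.ofReal (Real.exp ((∑ i, (B *ᵥ h) i ^ 2) / 4)) := by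
    intro h
    have := lintegral_exp_linear_gaussian fun i => (B *ᵥ h) i / √2
    simp only [div_pow, Real.sq_sqrt zero_le_two, ← Finset.sum_div, div_mul_eq_mul_div] at this
    simp only [← dotProduct_mulVec, dotProduct_comm _ (B *ᵥ h)]
    simp only [dotProduct, this]
    congr 2; ring
  simp_rw [lin]
  rw [lintegral_lintegral_swap]
  · simp_rw [lin']
    refine (lintegral_mono fun h => ?_).trans lintegral_exp_quarter_sq_gaussian.le
    gcongr
    exact hB h
  · simp only [Matrix.vecMul, dotProduct]
    fun_prop

/-! ### Norms and groups -/

section Norms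

variable {ι : Type*} [Fintype ι]

theorem l2norm_eq_sqrt (v : ι → ℝ) : l2norm v = √(∑ i, v i ^ 2) := by
  simp [l2norm, EuclideanSpace.norm_eq]

theorem l2norm_sq (v : ι → ℝ) : l2norm v ^ 2 = ∑ i, v i ^ 2 := by
  rw [l2norm_eq_sqrt, Real.sq_sqrt (Finset.sum_nonneg fun i _ => sq_nonneg _)]

theorem l2norm_nonneg (v : ι → ℝ) : 0 ≤ l2norm v := norm_nonneg _

theorem l1norm_nonneg (v : ι → ℝ) : 0 ≤ l1norm v := Finset.sum_nonneg fun _ _ => abs_nonneg _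

theorem dotProduct_le_l2norm_mul (v w : ι → ℝ) : ∑ i, v i * w i ≤ l2norm v * l2norm w := by
  rw [l2norm_eq_sqrt, l2norm_eq_sqrt]
  exact Real.sum_mul_le_sqrt_mul_sqrt _ _ _

theorem empNorm_eq {n : ℕ} (v : Fin n → ℝ) : empNorm v = l2norm v / √(n : ℝ) := by
  rw [empNorm, l2norm_eq_sqrt, Real.sqrt_mul (by positivity), one_div, Real.sqrt_inv]
  ring

theorem empNorm_nonneg {n : ℕ} (v : Fin n → ℝ) : 0 ≤ empNorm v := Real.sqrt_nonneg _

theorem empNorm_sq {n : ℕ} (v : Fin n → ℝ) : empNorm v ^ 2 = (1 / (n : ℝ)) * ∑ i, v i ^ 2 :=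
  Real.sq_sqrt (by positivity)

variable {p m : ℕ} {G : Fin m → Finset (Fin p)} {d : ℕ}

theorem groupNorm_nonneg (G : Fin m → Finset (Fin p)) (v : Fin p → ℝ) : 0 ≤ groupNorm G v :=
  Finset.sum_nonneg fun _ _ => l2norm_nonneg _

theorem l2norm_group_sq (v : Fin p → ℝ) (S : Finset (Fin p)) :
    l2norm (fun i : S => v i) ^ 2 = ∑ i ∈ S, v i ^ 2 := by
  rw [l2norm_sq, ← Finset.sum_coe_sort S fun i => v i ^ 2]

theorem IsGrouping.sum_eq (hG : IsGrouping G d) (f : Fin p → ℝ) :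
    ∑ j, ∑ i ∈ G j, f i = ∑ i, f i := by
  rw [← Finset.sum_biUnion fun j _ k _ hjk => hG.disjoint j k hjk]
  congr 1
  ext i
  simpa using hG.cover i

theorem IsGrouping.sum_l2norm_sq (hG : IsGrouping G d) (v : Fin p → ℝ) :
    ∑ j, l2norm (fun i : G j => v i) ^ 2 = l2norm v ^ 2 := by
  simp_rw [l2norm_group_sq, l2norm_sq, hG.sum_eq fun i => v i ^ 2]

end Norms

/-! ### Soft thresholding and block energies -/

/-- The total squared excess over `s₀ τ²` of the blocks of `s₀` coordinates of one group. -/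
def blockExcess {p m : ℕ} (G : Fin m → Finset (Fin p)) (s₀ : ℕ) (τ : ℝ) (W : Fin p → ℝ) : ℝ :=
  ∑ j, ∑ S ∈ (G j).powersetCard s₀, max 0 (∑ i ∈ S, W i ^ 2 - s₀ * τ ^ 2)

/-- If at most `s₀` coordinates exceed `τ`, one block contains them all, and its energy is at most
`s₀ τ²` plus the excess. Otherwise every large coordinate lies in a block of large coordinates,
where `(|W| - τ)² ≤ W² - τ²` charges everything to the excess. -/
theorem sqrt_sum_softThreshold_le {ι : Type*} [DecidableEq ι] {A : Finset ι} {s₀ : ℕ} (hs₀ : 1 ≤ s₀)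
    (hA : s₀ ≤ A.card) {τ : ℝ} (hτ : 0 ≤ τ) (W : ι → ℝ) :
    √(∑ i ∈ A, max 0 (|W i| - τ) ^ 2) ≤ τ * √(s₀ : ℝ) +
      √(∑ S ∈ A.powersetCard s₀, max 0 (∑ i ∈ S, W i ^ 2 - s₀ * τ ^ 2)) := by
  set e : ι → ℝ := fun i => max 0 (|W i| - τ) with he
  set T := A.filter fun i => τ < |W i| with hT
  set D := ∑ S ∈ A.powersetCard s₀, max 0 (∑ i ∈ S, W i ^ 2 - s₀ * τ ^ 2) with hD
  have hTA : T ⊆ A := Finset.filter_subset _ _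
  have hET : ∑ i ∈ A, e i ^ 2 = ∑ i ∈ T, e i ^ 2 := by
    refine (Finset.sum_subset hTA fun i hi hiT => ?_).symm
    have : |W i| ≤ τ := by
      by_contra h
      exact hiT (Finset.mem_filter.2 ⟨hi, not_le.1 h⟩)
    simp [he, this]
  have heW : ∀ i, e i ^ 2 ≤ W i ^ 2 := fun i => by
    rw [← sq_abs (W i)]
    refine pow_le_pow_left₀ (le_max_left _ _) (max_le (abs_nonneg _) ?_) 2
    linarith
  have hterm : ∀ S ∈ A.powersetCard s₀, ∑ i ∈ S, W i ^ 2 - s₀ * τ ^ 2 ≤ D := fun S hS =>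
    (le_max_right _ _).trans (Finset.single_le_sum
      (f := fun S => max 0 (∑ i ∈ S, W i ^ 2 - s₀ * τ ^ 2)) (fun _ _ => le_max_left _ _) hS)
  rcases le_total T.card s₀ with hc | hc
  · obtain ⟨S, hTS, hSA, hS⟩ := Finset.exists_subsuperset_card_eq hTA hc hA
    have h1 : ∑ i ∈ A, e i ^ 2 ≤ ∑ i ∈ S, W i ^ 2 := by
      rw [hET]
      exact (Finset.sum_le_sum_of_subset_of_nonneg hTS fun _ _ _ => sq_nonneg _).trans
        (Finset.sum_le_sum fun i _ => heW i)
    have h2 := hterm S (Finset.mem_powersetCard.2 ⟨hSA, hS⟩)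
    have h3 : 0 ≤ D := Finset.sum_nonneg fun _ _ => le_max_left _ _
    refine Real.sqrt_le_iff.2 ⟨by positivity, ?_⟩
    have h4 : 0 ≤ τ * √(s₀ : ℝ) * √D := by positivity
    nlinarith [Real.sq_sqrt h3, Real.sq_sqrt (Nat.cast_nonneg (α := ℝ) s₀)]
  · have h1 : ∑ i ∈ T, e i ^ 2 ≤ D := by
      calc ∑ i ∈ T, e i ^ 2 ≤ ∑ i ∈ T, ∑ S ∈ T.powersetCard s₀, if i ∈ S then e i ^ 2 else 0 := by
            refine Finset.sum_le_sum fun i hi => ?_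
            obtain ⟨S, hiS, hST, hS⟩ := Finset.exists_subsuperset_card_eq
              (Finset.singleton_subset_iff.2 hi) (by simpa using hs₀) hc
            refine le_trans ?_ (Finset.single_le_sum
              (f := fun S => if i ∈ S then e i ^ 2 else 0) (fun S _ => ?_)
              (Finset.mem_powersetCard.2 ⟨hST, hS⟩))
            · simp [Finset.singleton_subset_iff.1 hiS]
            · positivity
        _ = ∑ S ∈ T.powersetCard s₀, ∑ i ∈ S, e i ^ 2 := by
            rw [Finset.sum_comm]
            refine Finset.sum_congr rfl fun S hS => ?_
            rw [← Finset.sum_filter, Finset.filter_mem_eq_inter,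
              Finset.inter_eq_right.2 (Finset.mem_powersetCard.1 hS).1]
        _ ≤ ∑ S ∈ T.powersetCard s₀, max 0 (∑ i ∈ S, W i ^ 2 - s₀ * τ ^ 2) := by
            refine Finset.sum_le_sum fun S hS => le_max_of_le_right ?_
            obtain ⟨hST, hS⟩ := Finset.mem_powersetCard.1 hS
            rw [le_sub_iff_add_le, ← hS, ← nsmul_eq_mul, ← Finset.sum_const,
              ← Finset.sum_add_distrib]
            refine Finset.sum_le_sum fun i hi => ?_
            have h := (Finset.mem_filter.1 (hST hi)).2
            have : e i = |W i| - τ := max_eq_right (by linarith)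
            rw [this, ← sq_abs (W i)]
            nlinarith
        _ ≤ D := Finset.sum_le_sum_of_subset_of_nonneg (Finset.powersetCard_mono hTA)
            fun _ _ _ => le_max_left _ _
    rw [hET]
    exact (Real.sqrt_le_sqrt h1).trans (le_add_of_nonneg_left (by positivity))

/-- Split each `|W i|` into at most `τ` plus its soft threshold. The first part gives the `ℓ₁` term;
Cauchy–Schwarz within groups gives the group norm term, and a second one across groups collects the
excesses. -/
theorem dotProduct_le_of_blockExcess {p m d s₀ : ℕ} {G : Fin m → Finset (Fin p)}
    (hG : IsGrouping G d) (hs₀ : 1 ≤ s₀) (hs₀d : s₀ ≤ d) {τ : ℝ} (hτ : 0 ≤ τ)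
    (W u : Fin p → ℝ) :
    ∑ i, W i * u i ≤ τ * (l1norm u + √(s₀ : ℝ) * groupNorm G u) +
      √(blockExcess G s₀ τ W) * l2norm u := by
  set D : Fin m → ℝ :=
    fun j => ∑ S ∈ (G j).powersetCard s₀, max 0 (∑ i ∈ S, W i ^ 2 - s₀ * τ ^ 2) with hD
  have hD0 : ∀ j, 0 ≤ D j := fun j => Finset.sum_nonneg fun _ _ => le_max_left _ _
  have hcoord : ∀ i, W i * u i ≤ τ * |u i| + max 0 (|W i| - τ) * |u i| := fun i => by
    rw [← add_mul]
    refine (le_abs_self _).trans ?_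
    rw [abs_mul]
    gcongr
    linarith [le_max_right 0 (|W i| - τ)]
  have hgroup : ∀ j, ∑ i ∈ G j, max 0 (|W i| - τ) * |u i| ≤
      τ * √(s₀ : ℝ) * l2norm (fun i : G j => u i) + √(D j) * l2norm (fun i : G j => u i) := by
    intro j
    refine (Real.sum_mul_le_sqrt_mul_sqrt _ _ _).trans ?_
    simp only [sq_abs]
    rw [← add_mul, ← l2norm_group_sq u, Real.sqrt_sq (l2norm_nonneg _)]
    exact mul_le_mul_of_nonneg_right
      (sqrt_sum_softThreshold_le hs₀ (hs₀d.trans (hG.card j).ge) hτ W) (l2norm_nonneg fun i : G j => u i)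
  have hcs : ∑ j, √(D j) * l2norm (fun i : G j => u i) ≤
      √(blockExcess G s₀ τ W) * l2norm u := by
    refine (Real.sum_mul_le_sqrt_mul_sqrt _ _ _).trans (le_of_eq ?_)
    rw [hG.sum_l2norm_sq, Real.sqrt_sq (l2norm_nonneg _)]
    simp only [Real.sq_sqrt (hD0 _)]
    rfl
  calc ∑ i, W i * u i ≤ ∑ i, (τ * |u i| + max 0 (|W i| - τ) * |u i|) :=
        Finset.sum_le_sum fun i _ => hcoord i
    _ = τ * l1norm u + ∑ j, ∑ i ∈ G j, max 0 (|W i| - τ) * |u i| := by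
        rw [Finset.sum_add_distrib, ← Finset.mul_sum, hG.sum_eq fun i => max 0 (|W i| - τ) * |u i|]
        rfl
    _ ≤ τ * l1norm u + ∑ j, (τ * √(s₀ : ℝ) * l2norm (fun i : G j => u i) +
          √(D j) * l2norm (fun i : G j => u i)) := by
        gcongr with j
        exact hgroup j
    _ ≤ _ := by
        rw [Finset.sum_add_distrib, ← Finset.mul_sum]
        simp only [groupNorm]
        linarith

/-! ### Counting blocks -/

/-- The exponent per block coordinate, `log (2ed/s₀) + (2/s₀) log (4em/s)`. -/
noncomputable def logRate (m d s s₀ : ℕ) : ℝ :=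
  Real.log (2 * Real.exp 1 * d / s₀) + 2 / s₀ * Real.log (4 * Real.exp 1 * m / s)

theorem one_add_log_two_le_logRate {m d s s₀ : ℕ} (hs : 1 ≤ s) (hsm : s ≤ m) (hs₀ : 1 ≤ s₀)
    (hs₀d : s₀ ≤ d) : 1 + Real.log 2 ≤ logRate m d s s₀ := by
  have hs' : (0 : ℝ) < s := by exact_mod_cast hs
  have hs₀' : (0 : ℝ) < s₀ := by exact_mod_cast hs₀
  have hsm' : (s : ℝ) ≤ m := by exact_mod_cast hsm
  have hs₀d' : (s₀ : ℝ) ≤ d := by exact_mod_cast hs₀d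
  have he := Real.exp_pos 1
  have he1 : 1 ≤ Real.exp 1 := Real.one_le_exp zero_le_one
  have h1 : Real.log (2 * Real.exp 1) ≤ Real.log (2 * Real.exp 1 * d / s₀) := by
    refine Real.log_le_log (by positivity) ?_
    rw [le_div_iff₀ hs₀']
    gcongr
  have h2 : 0 ≤ Real.log (4 * Real.exp 1 * m / s) := by
    refine Real.log_nonneg ?_
    rw [le_div_iff₀ hs']
    nlinarith
  rw [Real.log_mul two_ne_zero he.ne', Real.log_exp] at h1
  have : 0 ≤ 2 / (s₀ : ℝ) * Real.log (4 * Real.exp 1 * m / s) := by positivity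
  unfold logRate
  linarith

theorem logRate_pos {m d s s₀ : ℕ} (hs : 1 ≤ s) (hsm : s ≤ m) (hs₀ : 1 ≤ s₀) (hs₀d : s₀ ≤ d) :
    0 < logRate m d s s₀ := by
  have := one_add_log_two_le_logRate hs hsm hs₀ hs₀d
  have := Real.log_nonneg one_le_two
  linarith

theorem exp_neg_mul_logRate {m d s s₀ : ℕ} (hs : 1 ≤ s) (hsm : s ≤ m) (hs₀ : 1 ≤ s₀)
    (hs₀d : s₀ ≤ d) : Real.exp (-(s₀ * logRate m d s s₀)) =
      ((s₀ : ℝ) / (2 * Real.exp 1 * d)) ^ s₀ * ((s : ℝ) / (4 * Real.exp 1 * m)) ^ 2 := by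
  have hs' : (0 : ℝ) < s := by exact_mod_cast hs
  have hs₀' : (0 : ℝ) < s₀ := by exact_mod_cast hs₀
  have hm' : (0 : ℝ) < m := by exact_mod_cast hs.trans hsm
  have hd' : (0 : ℝ) < d := by exact_mod_cast hs₀.trans hs₀d
  have he := Real.exp_pos 1
  have : -(s₀ * logRate m d s s₀) = s₀ * -Real.log (2 * Real.exp 1 * d / s₀) +
      (2 : ℕ) * -Real.log (4 * Real.exp 1 * m / s) := by
    unfold logRate
    field_simp
    push_cast
    ring
  rw [this, Real.exp_add, Real.exp_nat_mul, Real.exp_nat_mul, Real.exp_neg, Real.exp_neg,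
    Real.exp_log (by positivity), Real.exp_log (by positivity), inv_div, inv_div]

theorem choose_le_exp_mul_div_pow (d k : ℕ) :
    (d.choose k : ℝ) * (k : ℝ) ^ k ≤ (Real.exp 1 * d) ^ k := by
  have h1 : (d.choose k : ℝ) ≤ (d : ℝ) ^ k / k.factorial := Nat.choose_le_pow_div k d
  have h2 : (k : ℝ) ^ k / k.factorial ≤ Real.exp k := Real.pow_div_factorial_le_exp k (by positivity) k
  have h3 : Real.exp (k : ℝ) = Real.exp 1 ^ k := by rw [← Real.exp_nat_mul, mul_one]
  calc (d.choose k : ℝ) * (k : ℝ) ^ k ≤ (d : ℝ) ^ k / k.factorial * (k : ℝ) ^ k := by gcongr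
    _ = (d : ℝ) ^ k * ((k : ℝ) ^ k / k.factorial) := by ring
    _ ≤ (d : ℝ) ^ k * Real.exp 1 ^ k := by rw [← h3]; gcongr
    _ = _ := by rw [mul_pow, mul_comm]

/-- A union bound over `m * d.choose s₀` blocks, each with exponential moment at most `√2 ^ s₀`; the
prefactor `4` comes from `t + 1 ≤ exp t` at a quarter of the excess. The `2` inside the first
logarithm of `logRate` absorbs `√2 ^ s₀`. -/
theorem entropy_mul_exp_le {m d s s₀ : ℕ} (hs : 1 ≤ s) (hsm : s ≤ m) (hs₀ : 1 ≤ s₀)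
    (hs₀d : s₀ ≤ d) : m * (d.choose s₀ * (4 * (Real.exp (-(s₀ * logRate m d s s₀)) * √2 ^ s₀))) ≤
      (s : ℝ) / 4 := by
  have hs' : (0 : ℝ) < s := by exact_mod_cast hs
  have hm' : (0 : ℝ) < m := by exact_mod_cast hs.trans hsm
  have hd' : (0 : ℝ) < d := by exact_mod_cast hs₀.trans hs₀d
  have hsm' : (s : ℝ) ≤ m := by exact_mod_cast hsm
  have he := Real.exp_pos 1
  have he1 : 1 ≤ Real.exp 1 := Real.one_le_exp zero_le_one
  rw [exp_neg_mul_logRate hs hsm hs₀ hs₀d]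
  have h1 : (d.choose s₀ : ℝ) * ((s₀ : ℝ) / (2 * Real.exp 1 * d)) ^ s₀ * √2 ^ s₀ ≤ 1 := by
    have h2 : √2 ^ s₀ ≤ 2 ^ s₀ := pow_le_pow_left₀ (by positivity)
      (Real.sqrt_le_iff.2 ⟨by norm_num, by norm_num⟩) _
    have h3 := choose_le_exp_mul_div_pow d s₀
    rw [div_pow, mul_div_assoc', div_mul_eq_mul_div, div_le_one (by positivity)]
    calc _ ≤ (Real.exp 1 * d) ^ s₀ * 2 ^ s₀ := by gcongr
      _ = (2 * Real.exp 1 * d) ^ s₀ := by rw [← mul_pow]; ring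
  have h4 : ((s : ℝ) / (4 * Real.exp 1 * m)) ^ 2 ≤ s / (16 * m) := by
    rw [div_pow, div_le_div_iff₀ (by positivity) (by positivity)]
    have : (1 : ℝ) ≤ Real.exp 1 ^ 2 := one_le_pow₀ he1
    have h5 : (s : ℝ) * m ≤ Real.exp 1 ^ 2 * (m * m) := by nlinarith [mul_pos hm' hm']
    nlinarith [mul_le_mul_of_nonneg_left h5 hs'.le]
  calc _ = 4 * m * ((d.choose s₀ : ℝ) * ((s₀ : ℝ) / (2 * Real.exp 1 * d)) ^ s₀ * √2 ^ s₀) *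
        ((s : ℝ) / (4 * Real.exp 1 * m)) ^ 2 := by ring
    _ ≤ 4 * m * 1 * (s / (16 * m)) := by gcongr
    _ = s / 4 := by field_simp; norm_num

/-! ### The score under sparse group normalization -/

/-- The normalized score `Xᵀ x / √n`. -/
noncomputable def score {n p : ℕ} (X : Matrix (Fin n) (Fin p) ℝ) (x : Fin n → ℝ) : Fin p → ℝ :=
  fun i => Matrix.vecMul x X i / √(n : ℝ)

theorem continuous_score {n p : ℕ} (X : Matrix (Fin n) (Fin p) ℝ) : Continuous (score X) := by
  unfold score Matrix.vecMul dotProduct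
  fun_prop

theorem sum_score_mul {n p : ℕ} (X : Matrix (Fin n) (Fin p) ℝ) (x : Fin n → ℝ) (u : Fin p → ℝ) :
    ∑ i, score X x i * u i = (∑ k, x k * X.mulVec u k) / √(n : ℝ) := by
  have := Matrix.dotProduct_mulVec x X u
  simp only [dotProduct] at this
  rw [this, Finset.sum_div]
  exact Finset.sum_congr rfl fun i _ => by simp only [score]; ring

theorem continuous_blockExcess {p m : ℕ} (G : Fin m → Finset (Fin p)) (s₀ : ℕ) (τ : ℝ) :
    Continuous (blockExcess G s₀ τ) := by
  unfold blockExcess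
  fun_prop

section Normalization

variable {n p m d s₀ : ℕ} {X : Matrix (Fin n) (Fin p) ℝ} {G : Fin m → Finset (Fin p)}

theorem SparseGroupNormalized.sum_mulVec_sq_le (hX : SparseGroupNormalized X G s₀) {j : Fin m}
    {S : Finset (Fin p)} (hS : S ⊆ G j) (hc : S.card = s₀) (h : S → ℝ) :
    ∑ k, (X.submatrix id (fun i : S => (i : Fin p))).mulVec h k ^ 2 ≤ n * ∑ i, h i ^ 2 := by
  have h1 := Matrix.l2_opNorm_mulVec (X.submatrix id (fun i : S => (i : Fin p))) (WithLp.toLp 2 h)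
  have h2 := h1.trans (mul_le_mul_of_nonneg_right (hX j S hS hc) (norm_nonneg _))
  have h3 := mul_self_le_mul_self (norm_nonneg _) h2
  rw [← l2norm_sq, ← l2norm_sq]
  have h4 := Real.sq_sqrt (Nat.cast_nonneg (α := ℝ) n)
  rw [← h4, ← mul_pow, sq, sq]
  exact h3

theorem SparseGroupNormalized.lintegral_exp_score_le (hn : 1 ≤ n)
    (hX : SparseGroupNormalized X G s₀) {j : Fin m}
    {S : Finset (Fin p)} (hS : S ⊆ G j) (hc : S.card = s₀) :
    ∫⁻ x, ENNReal.ofReal (Real.exp ((∑ i ∈ S, score X x i ^ 2) / 4))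
      ∂(Measure.pi fun _ : Fin n => gaussianReal 0 1) ≤ ENNReal.ofReal (√2 ^ s₀) := by
  have hn' : (0 : ℝ) < n := by exact_mod_cast hn
  have key := lintegral_exp_quarter_sq_vecMul_le
    ((√(n : ℝ))⁻¹ • X.submatrix id (fun i : S => (i : Fin p))) ?_
  · rw [Fintype.card_coe, hc] at key
    convert key using 6 with x
    rw [← Finset.sum_coe_sort S fun i => score X x i ^ 2]
    refine Finset.sum_congr rfl fun i _ => ?_
    rw [Matrix.vecMul_smul, Pi.smul_apply, smul_eq_mul, score, div_eq_inv_mul]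
    rfl
  · intro h
    simp only [Matrix.smul_mulVec, Pi.smul_apply, smul_eq_mul, mul_pow, ← Finset.mul_sum]
    rw [inv_pow, Real.sq_sqrt hn'.le, inv_mul_le_iff₀ hn']
    exact hX.sum_mulVec_sq_le hS hc h

theorem SparseGroupNormalized.lintegral_blockExcess_le {s : ℕ} (hn : 1 ≤ n) (hs : 1 ≤ s)
    (hsm : s ≤ m) (hs₀ : 1 ≤ s₀) (hs₀d : s₀ ≤ d) (hG : IsGrouping G d)
    (hX : SparseGroupNormalized X G s₀) :
    ∫⁻ x, ENNReal.ofReal (blockExcess G s₀ (2 * √(logRate m d s s₀)) (score X x))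
      ∂(Measure.pi fun _ : Fin n => gaussianReal 0 1) ≤ ENNReal.ofReal (s / 4) := by
  have hL := logRate_pos hs hsm hs₀ hs₀d
  set Λ := logRate m d s s₀ with hΛ
  -- This is `t + 1 ≤ exp t` with `4t` equal to the block energy minus `4 s₀ Λ`; the threshold `2√Λ`
  -- is chosen to leave exactly the factor `exp (-s₀ Λ)`.
  have hpt : ∀ (S : Finset (Fin p)) (x : Fin n → ℝ),
      max 0 (∑ i ∈ S, score X x i ^ 2 - s₀ * (2 * √Λ) ^ 2) ≤
        4 * Real.exp (-(s₀ * Λ)) * Real.exp ((∑ i ∈ S, score X x i ^ 2) / 4) := by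
    intro S x
    rw [mul_assoc, ← Real.exp_add]
    refine max_le (by positivity) ?_
    rw [mul_pow, Real.sq_sqrt hL.le]
    linarith [Real.add_one_le_exp (-(s₀ * Λ) + (∑ i ∈ S, score X x i ^ 2) / 4)]
  have hmeas : ∀ S : Finset (Fin p), Measurable fun x : Fin n → ℝ =>
      ENNReal.ofReal (Real.exp ((∑ i ∈ S, score X x i ^ 2) / 4)) := fun S => by
    have := (continuous_score X).measurable
    fun_prop
  have hterm : ∀ j, ∀ S ∈ (G j).powersetCard s₀,
      ∫⁻ x, ENNReal.ofReal (max 0 (∑ i ∈ S, score X x i ^ 2 - s₀ * (2 * √Λ) ^ 2))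
        ∂(Measure.pi fun _ : Fin n => gaussianReal 0 1) ≤
      ENNReal.ofReal (4 * (Real.exp (-(s₀ * Λ)) * √2 ^ s₀)) := by
    intro j S hS
    obtain ⟨hS, hc⟩ := Finset.mem_powersetCard.1 hS
    refine (lintegral_mono fun x => ENNReal.ofReal_le_ofReal (hpt S x)).trans ?_
    simp_rw [ENNReal.ofReal_mul (p := 4 * Real.exp (-(s₀ * Λ))) (by positivity)]
    rw [lintegral_const_mul _ (hmeas S), ← mul_assoc,
      ENNReal.ofReal_mul (p := 4 * Real.exp (-(s₀ * Λ))) (by positivity)]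
    gcongr
    exact hX.lintegral_exp_score_le hn hS hc
  have hmeas' : ∀ S : Finset (Fin p), Measurable fun x : Fin n → ℝ =>
      ENNReal.ofReal (max 0 (∑ i ∈ S, score X x i ^ 2 - s₀ * (2 * √Λ) ^ 2)) := fun S => by
    have := (continuous_score X).measurable
    fun_prop
  unfold blockExcess
  simp_rw [ENNReal.ofReal_sum_of_nonneg fun j _ => Finset.sum_nonneg fun S _ => le_max_left 0 _,
    ENNReal.ofReal_sum_of_nonneg fun S _ => le_max_left 0 _]
  rw [lintegral_finsetSum _ fun j _ => Finset.measurable_sum _ fun S _ => hmeas' S]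
  simp_rw [lintegral_finsetSum _ fun S _ => hmeas' S]
  calc _ ≤ ∑ j : Fin m, ∑ S ∈ (G j).powersetCard s₀,
        ENNReal.ofReal (4 * (Real.exp (-(s₀ * Λ)) * √2 ^ s₀)) :=
        Finset.sum_le_sum fun j _ => Finset.sum_le_sum fun S hS => hterm j S hS
    _ = ENNReal.ofReal (m * (d.choose s₀ * (4 * (Real.exp (-(s₀ * Λ)) * √2 ^ s₀)))) := by
        simp only [Finset.sum_const, Finset.card_powersetCard, hG.card, Finset.card_univ,
          Fintype.card_fin, nsmul_eq_mul]
        rw [ENNReal.ofReal_mul (Nat.cast_nonneg m), ENNReal.ofReal_mul (Nat.cast_nonneg _),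
          ENNReal.ofReal_natCast, ENNReal.ofReal_natCast]
    _ ≤ _ := ENNReal.ofReal_le_ofReal (entropy_mul_exp_le hs hsm hs₀ hs₀d)

theorem SparseGroupNormalized.sum_col_sq_le (hX : SparseGroupNormalized X G s₀)
    (hG : IsGrouping G d) (hs₀ : 1 ≤ s₀) (hs₀d : s₀ ≤ d) (i : Fin p) :
    ∑ k, X k i ^ 2 ≤ n := by
  obtain ⟨j, hj⟩ := hG.cover i
  obtain ⟨S, hiS, hS, hc⟩ := Finset.exists_subsuperset_card_eq
    (Finset.singleton_subset_iff.2 hj) (by simpa using hs₀) (hs₀d.trans (hG.card j).ge)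
  have := hX.sum_mulVec_sq_le hS hc (Pi.single ⟨i, Finset.singleton_subset_iff.1 hiS⟩ 1)
  simpa [Pi.single_apply] using this

/-- Every column lies in some block, hence has Euclidean norm at most `√n`; the triangle inequality
follows. This makes the prediction term redundant for small `ρ`. -/
theorem SparseGroupNormalized.empNorm_mulVec_le (hn : 1 ≤ n) (hX : SparseGroupNormalized X G s₀)
    (hG : IsGrouping G d) (hs₀ : 1 ≤ s₀) (hs₀d : s₀ ≤ d) (u : Fin p → ℝ) :
    empNorm (X.mulVec u) ≤ l1norm u := by
  have hn' : (0 : ℝ) < n := by exact_mod_cast hn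
  rw [empNorm_eq, div_le_iff₀ (by positivity)]
  have hcol : ∀ i, ‖WithLp.toLp 2 (X.col i)‖ ≤ √(n : ℝ) := fun i => by
    have : ‖WithLp.toLp 2 (X.col i)‖ = l2norm (X.col i) := rfl
    rw [this, l2norm_eq_sqrt]
    exact Real.sqrt_le_sqrt (hX.sum_col_sq_le hG hs₀ hs₀d i)
  have : WithLp.toLp 2 (X.mulVec u) = ∑ i, u i • WithLp.toLp 2 (X.col i) := by
    ext k
    simp [Matrix.mulVec, dotProduct, Matrix.col, mul_comm]
  calc l2norm (X.mulVec u) = ‖∑ i, u i • WithLp.toLp 2 (X.col i)‖ := by rw [← this]; rfl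
    _ ≤ ∑ i, ‖u i • WithLp.toLp 2 (X.col i)‖ := norm_sum_le _ _
    _ ≤ ∑ i, |u i| * √(n : ℝ) := Finset.sum_le_sum fun i _ => by
        rw [norm_smul, Real.norm_eq_abs]
        gcongr
        exact hcol i
    _ = l1norm u * √(n : ℝ) := by rw [← Finset.sum_mul]; rfl

end Normalization

/-! ### Uniform noise bounds and concentration -/

/-- The sparse group penalty `‖u‖₁ + √s₀ ‖u‖_{1,2}`. -/
noncomputable def penalty {p m : ℕ} (G : Fin m → Finset (Fin p)) (s₀ : ℕ) (u : Fin p → ℝ) : ℝ :=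
  l1norm u + √(s₀ : ℝ) * groupNorm G u

/-- The larger of the penalty and its bound `2 √(s s₀) ‖u‖₂` on sparse vectors. -/
noncomputable def penaltyMax {p m : ℕ} (G : Fin m → Finset (Fin p)) (s s₀ : ℕ) (u : Fin p → ℝ) :
    ℝ :=
  max (penalty G s₀ u) (2 * √((s : ℝ) * s₀) * l2norm u)

theorem l1norm_le_penalty {p m : ℕ} (G : Fin m → Finset (Fin p)) (s₀ : ℕ) (u : Fin p → ℝ) :
    l1norm u ≤ penalty G s₀ u :=
  le_add_of_nonneg_right (mul_nonneg (Real.sqrt_nonneg _) (groupNorm_nonneg G u))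

theorem penalty_nonneg {p m : ℕ} (G : Fin m → Finset (Fin p)) (s₀ : ℕ) (u : Fin p → ℝ) :
    0 ≤ penalty G s₀ u := (l1norm_nonneg u).trans (l1norm_le_penalty G s₀ u)

/-- Noise vectors whose score is bounded by `c √L` times the penalty. -/
def penaltyBoundSet {n p m : ℕ} (X : Matrix (Fin n) (Fin p) ℝ) (G : Fin m → Finset (Fin p))
    (d s s₀ : ℕ) : Set (Fin n → ℝ) :=
  {x | ∀ u, ∑ i, score X x i * u i ≤ (1 + √2) * (√(logRate m d s s₀) * penaltyMax G s s₀ u)}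

/-- Noise vectors whose score is bounded by the penalty or by `ρ` times the prediction norm. -/
def scoreBoundSet {n p m : ℕ} (X : Matrix (Fin n) (Fin p) ℝ) (G : Fin m → Finset (Fin p))
    (d s s₀ : ℕ) (ρ : ℝ) : Set (Fin n → ℝ) :=
  {x | ∀ u, ∑ i, score X x i * u i ≤ (4 + √2) *
    max (√(logRate m d s s₀) * penaltyMax G s s₀ u) (ρ * empNorm (X.mulVec u))}

section Concentration

variable {n p m d s s₀ : ℕ} {X : Matrix (Fin n) (Fin p) ℝ} {G : Fin m → Finset (Fin p)}

theorem measurableSet_setOf_score_le (X : Matrix (Fin n) (Fin p) ℝ) (F : (Fin p → ℝ) → ℝ) :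
    MeasurableSet {x | ∀ u, ∑ i, score X x i * u i ≤ F u} := by
  rw [Set.ofPred_forall]
  refine (isClosed_iInter fun u => isClosed_le ?_ continuous_const).measurableSet
  have := continuous_score X
  fun_prop

theorem half_le_measure_penaltyBoundSet (hn : 1 ≤ n) (hs : 1 ≤ s)
    (hsm : s ≤ m) (hs₀ : 1 ≤ s₀) (hs₀d : s₀ ≤ d) (hG : IsGrouping G d)
    (hX : SparseGroupNormalized X G s₀) :
    1 / 2 ≤ (Measure.pi fun _ : Fin n => gaussianReal 0 1) (penaltyBoundSet X G d s s₀) := by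
  set γ := Measure.pi fun _ : Fin n => gaussianReal 0 1
  set Λ := logRate m d s s₀ with hΛ
  have hs' : (1 : ℝ) ≤ s := by exact_mod_cast hs
  have hs₀' : (1 : ℝ) ≤ s₀ := by exact_mod_cast hs₀
  have hL : 1 ≤ Λ := by
    have := one_add_log_two_le_logRate hs hsm hs₀ hs₀d
    have := Real.log_nonneg one_le_two
    linarith
  have hsub : (penaltyBoundSet X G d s s₀)ᶜ ⊆ {x | ENNReal.ofReal (s / 2) ≤
      ENNReal.ofReal (blockExcess G s₀ (2 * √Λ) (score X x))} := by
    intro x hx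
    by_contra hD
    refine hx fun u => ?_
    simp only [Set.mem_ofPred_eq, not_le] at hD
    have hD' : blockExcess G s₀ (2 * √Λ) (score X x) ≤ s / 2 :=
      (ENNReal.ofReal_lt_ofReal_iff (by linarith)).1 hD |>.le
    have hsL : 1 ≤ √Λ := Real.one_le_sqrt.2 hL
    have h2 : √2 ^ 2 = 2 := Real.sq_sqrt zero_le_two
    have h2' : 1.41 ≤ √2 := Real.le_sqrt_of_sq_le (by norm_num)
    have hu := l2norm_nonneg u
    have hP : penalty G s₀ u ≤ penaltyMax G s s₀ u := le_max_left _ _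
    have hQ : 2 * √((s : ℝ) * s₀) * l2norm u ≤ penaltyMax G s s₀ u := le_max_right _ _
    -- The constant `1 + √2` splits as `2`, from the threshold `2√Λ`, plus `√2 - 1`, which suffices
    -- for the excess since `s/2 ≤ 4 (√2 - 1)² s s₀`.
    have hDs : √(blockExcess G s₀ (2 * √Λ) (score X x)) ≤
        (√2 - 1) * (2 * √((s : ℝ) * s₀)) := by
      refine Real.sqrt_le_iff.2 ⟨by nlinarith [Real.sqrt_nonneg ((s : ℝ) * s₀)], ?_⟩
      rw [mul_pow, mul_pow, Real.sq_sqrt (by positivity)]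
      have h3 : (s : ℝ) ≤ s * s₀ := le_mul_of_one_le_right (by positivity) hs₀'
      have h4 : 0.16 ≤ (√2 - 1) ^ 2 := by nlinarith
      nlinarith
    have key := dotProduct_le_of_blockExcess hG hs₀ hs₀d (τ := 2 * √Λ) (by positivity)
      (score X x) u
    have hN : 0 ≤ penaltyMax G s s₀ u := (penalty_nonneg G s₀ u).trans hP
    calc _ ≤ 2 * √Λ * penalty G s₀ u + √(blockExcess G s₀ (2 * √Λ) (score X x)) * l2norm u := key
      _ ≤ 2 * √Λ * penaltyMax G s s₀ u + (√2 - 1) * (2 * √((s : ℝ) * s₀)) * l2norm u := by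
          gcongr
      _ = 2 * √Λ * penaltyMax G s s₀ u + (√2 - 1) * 1 * (2 * √((s : ℝ) * s₀) * l2norm u) := by
          ring
      _ ≤ 2 * √Λ * penaltyMax G s s₀ u + (√2 - 1) * √Λ * penaltyMax G s s₀ u := by
          have : 0 ≤ √2 - 1 := by linarith
          gcongr
      _ = _ := by ring
  have hmeas : Measurable fun x : Fin n → ℝ =>
      ENNReal.ofReal (blockExcess G s₀ (2 * √Λ) (score X x)) := by
    have := ((continuous_blockExcess G s₀ (2 * √Λ)).comp (continuous_score X)).measurable
    exact this.ennreal_ofReal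
  -- Markov at level `s/2`, twice the bound `s/4` on the mean, leaves probability at most `1/2`.
  have hmk := (mul_meas_ge_le_lintegral hmeas (ENNReal.ofReal (s / 2)) (μ := γ)).trans
    (hX.lintegral_blockExcess_le hn hs hsm hs₀ hs₀d hG)
  have hc : γ (penaltyBoundSet X G d s s₀)ᶜ ≤ 1 / 2 := by
    refine (measure_mono hsub).trans ?_
    have e : ENNReal.ofReal (s / 4) = ENNReal.ofReal (s / 2) * (1 / 2) := by
      rw [show (1 / 2 : ℝ≥0∞) = ENNReal.ofReal (1 / 2) by
        rw [ENNReal.ofReal_div_of_pos two_pos]; simp, ← ENNReal.ofReal_mul (by positivity)]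
      congr 1; ring
    rw [e] at hmk
    exact (ENNReal.mul_le_mul_iff_right (by simp; linarith) (by simp)).1 hmk
  have hA : MeasurableSet (penaltyBoundSet X G d s s₀) := measurableSet_setOf_score_le X _
  rw [prob_compl_eq_one_sub hA, tsub_le_iff_left] at hc
  have h3 : (1 / 2 : ℝ≥0∞) + 1 / 2 ≤ γ (penaltyBoundSet X G d s s₀) + 1 / 2 := by
    rwa [ENNReal.add_halves]
  exact (ENNReal.add_le_add_iff_right (by simp)).1 h3

/-- Concentration around a convex set, by property (τ). -/
theorem measure_compl_scoreBoundSet_mul_le (hn : 1 ≤ n) {ρ : ℝ} (hρ : 0 ≤ ρ) :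
    ENNReal.ofReal (Real.exp (9 * ρ ^ 2 / 4)) *
      (Measure.pi fun _ : Fin n => gaussianReal 0 1) (scoreBoundSet X G d s s₀ ρ)ᶜ *
      (Measure.pi fun _ : Fin n => gaussianReal 0 1) (penaltyBoundSet X G d s s₀) ≤ 1 := by
  have hn' : (0 : ℝ) < n := by exact_mod_cast hn
  have hA : MeasurableSet (penaltyBoundSet X G d s s₀) := measurableSet_setOf_score_le X _
  have hB : MeasurableSet (scoreBoundSet X G d s s₀ ρ)ᶜ := (measurableSet_setOf_score_le X _).compl
  have key := lintegral_mul_lintegral_pi_gaussianReal_le_one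
    (u := (scoreBoundSet X G d s s₀ ρ)ᶜ.indicator
      fun _ => ENNReal.ofReal (Real.exp (9 * ρ ^ 2 / 4)))
    (v := (penaltyBoundSet X G d s s₀).indicator fun _ => 1)
    (measurable_const.indicator hB) (measurable_const.indicator hA) ?_
  · rwa [lintegral_indicator_const hB, lintegral_indicator_const hA, one_mul] at key
  · intro x y
    by_cases hx : x ∈ (scoreBoundSet X G d s s₀ ρ)ᶜ
    swap; · simp [Set.indicator_of_notMem hx]
    by_cases hy : y ∈ penaltyBoundSet X G d s s₀
    swap; · simp [Set.indicator_of_notMem hy]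
    rw [Set.indicator_of_mem hx, Set.indicator_of_mem hy, mul_one]
    refine ENNReal.ofReal_le_ofReal (Real.exp_le_exp.2 ?_)
    rw [scoreBoundSet, Set.mem_compl_iff, Set.mem_ofPred_eq, not_forall] at hx
    obtain ⟨u, hu⟩ := hx
    rw [not_le] at hu
    have hyu := hy u
    have h1 := le_max_left (√(logRate m d s s₀) * penaltyMax G s s₀ u) (ρ * empNorm (X.mulVec u))
    have h2 := le_max_right (√(logRate m d s s₀) * penaltyMax G s s₀ u) (ρ * empNorm (X.mulVec u))
    have hcs : ∑ i, score X x i * u i - ∑ i, score X y i * u i ≤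
        l2norm (x - y) * empNorm (X.mulVec u) := by
      rw [sum_score_mul, sum_score_mul, ← sub_div, ← Finset.sum_sub_distrib, empNorm_eq,
        mul_div_assoc']
      simp only [← sub_mul]
      gcongr
      exact dotProduct_le_l2norm_mul (x - y) (X.mulVec u)
    -- The constants `4 + √2` and `1 + √2` differ by `3`, so a violating point is farther than `3ρ`
    -- from every point of the other set. This is the source of `exp (9ρ²/4)`.
    have h3 : 3 * ρ * empNorm (X.mulVec u) < l2norm (x - y) * empNorm (X.mulVec u) := by
      have : 0 ≤ √2 := Real.sqrt_nonneg _
      nlinarith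
    have h4 : 3 * ρ < l2norm (x - y) := lt_of_mul_lt_mul_right h3 (empNorm_nonneg _)
    have h5 := l2norm_sq (x - y)
    simp only [Pi.sub_apply] at h5
    rw [← h5]
    nlinarith

theorem measure_compl_scoreBoundSet_le_of_le (hn : 1 ≤ n) (hs : 1 ≤ s)
    (hsm : s ≤ m) (hs₀ : 1 ≤ s₀) (hs₀d : s₀ ≤ d) (hG : IsGrouping G d)
    (hX : SparseGroupNormalized X G s₀) {ρ : ℝ} (hρ : 0 ≤ ρ) (hLρ : logRate m d s s₀ ≤ ρ ^ 2) :
    (Measure.pi fun _ : Fin n => gaussianReal 0 1).real (scoreBoundSet X G d s s₀ ρ)ᶜ ≤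
      Real.exp (-ρ ^ 2) / 2 := by
  have hA := half_le_measure_penaltyBoundSet hn hs hsm hs₀ hs₀d hG hX
  have key := measure_compl_scoreBoundSet_mul_le (X := X) (G := G) (d := d) (s := s) (s₀ := s₀)
    hn hρ
  set γ := Measure.pi fun _ : Fin n => gaussianReal 0 1
  have k2 := ENNReal.toReal_mono ENNReal.one_ne_top key
  have hA' := ENNReal.toReal_mono (measure_ne_top _ _) hA
  rw [ENNReal.toReal_mul, ENNReal.toReal_mul, ENNReal.toReal_ofReal (Real.exp_pos _).le,
    ENNReal.toReal_one] at k2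
  simp only [ENNReal.toReal_div, ENNReal.toReal_one, ENNReal.toReal_ofNat] at hA'
  rw [measureReal_def]
  set b := (γ (scoreBoundSet X G d s s₀ ρ)ᶜ).toReal
  have hb : 0 ≤ b := ENNReal.toReal_nonneg
  have he := Real.exp_pos (9 * ρ ^ 2 / 4)
  have k3 : Real.exp (9 * ρ ^ 2 / 4) * b ≤ 2 := by
    nlinarith [mul_le_mul_of_nonneg_left hA' (mul_nonneg he.le hb)]
  -- The surplus `5ρ²/4` in the exponent pays for the factor `4`, because `ρ² ≥ 1 + log 2`.
  have k4 : 4 * Real.exp (ρ ^ 2) ≤ Real.exp (9 * ρ ^ 2 / 4) := by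
    have h4 : (4 : ℝ) = Real.exp (2 * Real.log 2) := by
      rw [two_mul, Real.exp_add, Real.exp_log two_pos]; norm_num
    have h5 : 4 * Real.exp (ρ ^ 2) = Real.exp (2 * Real.log 2 + ρ ^ 2) := by
      rw [Real.exp_add, ← h4]
    rw [h5]
    refine Real.exp_le_exp.2 ?_
    have := one_add_log_two_le_logRate hs hsm hs₀ hs₀d
    linarith [Real.log_two_lt_d9]
  have k5 : Real.exp (ρ ^ 2) * b ≤ 1 / 2 := by nlinarith
  rw [Real.exp_neg]
  have := Real.exp_pos (ρ ^ 2)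
  rw [div_eq_mul_one_div, inv_mul_eq_div, le_div_iff₀ this]
  linarith

theorem one_sub_le_measureReal_scoreBoundSet (hn : 1 ≤ n) (hs : 1 ≤ s)
    (hsm : s ≤ m) (hs₀ : 1 ≤ s₀) (hs₀d : s₀ ≤ d) (hG : IsGrouping G d)
    (hX : SparseGroupNormalized X G s₀) {δ₀ : ℝ} (hδ : 0 < δ₀) :
    1 - δ₀ / 2 ≤ (Measure.pi fun _ : Fin n => gaussianReal 0 1).real
      (scoreBoundSet X G d s s₀ √(Real.log (1 / δ₀))) := by
  set γ := Measure.pi fun _ : Fin n => gaussianReal 0 1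
  have hB : ∀ ρ, MeasurableSet (scoreBoundSet X G d s s₀ ρ) := fun ρ =>
    measurableSet_setOf_score_le X _
  suffices h : γ.real (scoreBoundSet X G d s s₀ √(Real.log (1 / δ₀)))ᶜ ≤ δ₀ / 2 by
    rw [probReal_compl_eq_one_sub (hB _)] at h
    linarith
  have hL := logRate_pos hs hsm hs₀ hs₀d
  have hlog : Real.exp (-Real.log (1 / δ₀)) = δ₀ := by
    rw [one_div, Real.log_inv, neg_neg, Real.exp_log hδ]
  rcases le_total (logRate m d s s₀) (Real.log (1 / δ₀)) with h | h
  · have hsq := Real.sq_sqrt (hL.le.trans h)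
    have := measure_compl_scoreBoundSet_le_of_le hn hs hsm hs₀ hs₀d hG hX (Real.sqrt_nonneg _)
      (hsq.symm ▸ h)
    rwa [hsq, hlog] at this
  -- For larger `δ₀`, take `ρ² = logRate`: there the prediction term never exceeds the penalty term,
  -- so this event lies inside the required one.
  · have hsq := Real.sq_sqrt hL.le
    have := measure_compl_scoreBoundSet_le_of_le hn hs hsm hs₀ hs₀d hG hX
      (Real.sqrt_nonneg (logRate m d s s₀)) hsq.ge
    rw [hsq] at this
    have hexp : Real.exp (-logRate m d s s₀) ≤ δ₀ := by
      rw [← hlog]; exact Real.exp_le_exp.2 (neg_le_neg h)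
    refine ((measureReal_mono (Set.compl_subset_compl.2 fun x hx u => (hx u).trans ?_)).trans
      this).trans (by linarith)
    rw [max_eq_left]
    · gcongr
      exact le_max_left _ _
    · gcongr
      exact (hX.empNorm_mulVec_le hn hG hs₀ hs₀d u).trans
        ((l1norm_le_penalty G s₀ u).trans (le_max_left _ _))

end Concentration

/-! ### Deterministic analysis of the estimator -/

section Deterministic

theorem l2norm_smul_add_smul_le {ι : Type*} [Fintype ι] {a b : ℝ} (ha : 0 ≤ a) (hb : 0 ≤ b)
    (v w : ι → ℝ) : l2norm (a • v + b • w) ≤ a * l2norm v + b * l2norm w := by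
  simp only [l2norm, WithLp.toLp_add, WithLp.toLp_smul]
  refine (norm_add_le _ _).trans (le_of_eq ?_)
  rw [norm_smul, norm_smul, Real.norm_of_nonneg ha, Real.norm_of_nonneg hb]

theorem l1norm_smul_add_smul_le {ι : Type*} [Fintype ι] {a b : ℝ} (ha : 0 ≤ a) (hb : 0 ≤ b)
    (v w : ι → ℝ) : l1norm (a • v + b • w) ≤ a * l1norm v + b * l1norm w := by
  simp only [l1norm, Finset.mul_sum, ← Finset.sum_add_distrib]
  refine Finset.sum_le_sum fun i _ => (abs_add_le _ _).trans (le_of_eq ?_)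
  simp [abs_mul, abs_of_nonneg ha, abs_of_nonneg hb]

theorem penalty_smul_add_smul_le {p m : ℕ} (G : Fin m → Finset (Fin p)) (s₀ : ℕ) {a b : ℝ}
    (ha : 0 ≤ a) (hb : 0 ≤ b) (v w : Fin p → ℝ) :
    penalty G s₀ (a • v + b • w) ≤ a * penalty G s₀ v + b * penalty G s₀ w := by
  have h2 : groupNorm G (a • v + b • w) ≤ a * groupNorm G v + b * groupNorm G w := by
    simp only [groupNorm, Finset.mul_sum, ← Finset.sum_add_distrib]
    exact Finset.sum_le_sum fun j _ => l2norm_smul_add_smul_le ha hb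
      (fun i : G j => v i) fun i : G j => w i
  have h1 := l1norm_smul_add_smul_le ha hb v w
  have := mul_le_mul_of_nonneg_left h2 (Real.sqrt_nonneg (s₀ : ℝ))
  simp only [penalty]
  linarith

/-- Serves both the coordinates and the groups: off the support the difference is exactly `-z i`, on
it at most `z i`, and Cauchy–Schwarz over the support produces `√k`. -/
theorem sum_sub_sum_le {ι : Type*} [Fintype ι] [DecidableEq ι] (S : Finset ι) {k : ℕ}
    (hk : S.card ≤ k) {x y z : ι → ℝ} (hxyz : ∀ i, x i ≤ y i + z i) (hz : ∀ i, 0 ≤ z i)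
    (hS : ∀ i ∉ S, x i = 0 ∧ y i = z i) :
    ∑ i, x i - ∑ i, y i ≤ √(k : ℝ) * √(∑ i, z i ^ 2) ∧
      ∑ i, x i - ∑ i, y i ≤ 2 * (√(k : ℝ) * √(∑ i, z i ^ 2)) - ∑ i, z i := by
  have hcs : ∑ i ∈ S, z i ≤ √(k : ℝ) * √(∑ i, z i ^ 2) := by
    have h1 := Real.sum_mul_le_sqrt_mul_sqrt S (fun _ => 1) z
    simp only [one_mul, one_pow, Finset.sum_const, nsmul_eq_mul, mul_one] at h1
    refine h1.trans ?_
    gcongr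
    exact Finset.subset_univ S
  have h0 : ∀ i, x i - y i ≤ 2 * (if i ∈ S then z i else 0) - z i := fun i => by
    split_ifs with hi
    · linarith [hxyz i]
    · rw [(hS i hi).1, (hS i hi).2]; linarith
  have h1 := Finset.sum_le_sum fun i (_ : i ∈ Finset.univ) => h0 i
  rw [Finset.sum_sub_distrib, Finset.sum_sub_distrib, ← Finset.mul_sum, Finset.sum_ite_mem,
    Finset.univ_inter] at h1
  have h2 : ∑ i ∈ S, z i ≤ ∑ i, z i :=
    Finset.sum_le_sum_of_subset_of_nonneg (Finset.subset_univ S) fun i _ _ => hz i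
  constructor <;> linarith

theorem IsDoubleSparse.penalty_sub_le {p m d s s₀ : ℕ} {G : Fin m → Finset (Fin p)}
    (hG : IsGrouping G d) {β : Fin p → ℝ} (hβ : IsDoubleSparse G s s₀ β) (b : Fin p → ℝ) :
    penalty G s₀ β - penalty G s₀ b ≤ 2 * √((s : ℝ) * s₀) * l2norm (b - β) ∧
      penalty G s₀ β - penalty G s₀ b ≤
        4 * √((s : ℝ) * s₀) * l2norm (b - β) - penalty G s₀ (b - β) := by
  have h1 := sum_sub_sum_le (Finset.univ.filter fun i => β i ≠ 0) hβ.2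
    (x := fun i => |β i|) (y := fun i => |b i|) (z := fun i => |(b - β) i|)
    (fun i => by
      have := abs_sub_abs_le_abs_sub (β i) (b i)
      rw [abs_sub_comm] at this
      simp only [Pi.sub_apply]
      linarith) (fun i => abs_nonneg _)
    (fun i hi => by
      have : β i = 0 := by simpa using hi
      simp [this])
  have h2 := sum_sub_sum_le (Finset.univ.filter fun j => ∃ i ∈ G j, β i ≠ 0) hβ.1
    (x := fun j => l2norm fun i : G j => β i) (y := fun j => l2norm fun i : G j => b i)
    (z := fun j => l2norm fun i : G j => (b - β) i)
    (fun j => by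
      have := norm_sub_norm_le (WithLp.toLp 2 fun i : G j => β i)
        (WithLp.toLp 2 fun i : G j => b i)
      rw [norm_sub_rev] at this
      have e : l2norm (fun i : G j => (b - β) i) = ‖WithLp.toLp 2 (fun i : G j => b i) -
        WithLp.toLp 2 fun i : G j => β i‖ := rfl
      rw [e]
      simp only [l2norm]
      linarith) (fun j => l2norm_nonneg _)
    (fun j hj => by
      have h0 : ∀ i ∈ G j, β i = 0 := by simpa using hj
      have e : (fun i : G j => β i) = 0 := funext fun i => h0 i i.2
      refine ⟨by rw [e]; simp [l2norm], ?_⟩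
      congr 1
      funext i
      simp [h0 i i.2])
  rw [hG.sum_l2norm_sq, Real.sqrt_sq (l2norm_nonneg _)] at h2
  simp only [sq_abs] at h1
  rw [← l2norm_eq_sqrt] at h1
  push_cast at h1
  have hs₀ := Real.sqrt_nonneg (s₀ : ℝ)
  have e : √(s₀ : ℝ) * (√(s : ℝ) * l2norm (b - β)) = √((s : ℝ) * s₀) * l2norm (b - β) := by
    rw [Real.sqrt_mul (Nat.cast_nonneg s)]; ring
  have k1 := mul_le_mul_of_nonneg_left h2.1 hs₀
  have k2 := mul_le_mul_of_nonneg_left h2.2 hs₀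
  have h3 := h1.1
  have h4 := h1.2
  simp only [penalty, l1norm, groupNorm]
  constructor
  · linarith
  · have : √(s₀ : ℝ) * (2 * (√(s : ℝ) * l2norm (b - β))) =
      2 * (√((s : ℝ) * s₀) * l2norm (b - β)) := by rw [← e]; ring
    linarith

variable {n p m d s s₀ : ℕ} {X : Matrix (Fin n) (Fin p) ℝ} {G : Fin m → Finset (Fin p)}

/-- Comparing `b` with points of the segment towards `β` near `b`, instead of with `β` itself, uses
convexity of the penalty and saves a factor `2` in front of the right-hand side. -/
theorem IsSolution.empNorm_sq_le {lam : ℝ} {β b : Fin p → ℝ} {e : Fin n → ℝ}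
    (hb : IsSolution X G s₀ lam (X.mulVec β + e) b) (hlam : 0 ≤ lam) :
    empNorm (X.mulVec (b - β)) ^ 2 ≤ 1 / n * ∑ k, e k * X.mulVec (b - β) k +
      lam * (penalty G s₀ β - penalty G s₀ b) := by
  set u := b - β with hu
  set Q := empNorm (X.mulVec u) ^ 2 with hQ
  set A := 1 / (n : ℝ) * ∑ k, e k * X.mulVec u k with hA
  have hfit : ∀ c : ℝ, empNorm (X.mulVec β + e - X.mulVec (β + c • u)) ^ 2 =
      1 / n * ∑ k, e k ^ 2 - 2 * c * A + c ^ 2 * Q := by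
    intro c
    have : X.mulVec β + e - X.mulVec (β + c • u) = e - c • X.mulVec u := by
      rw [Matrix.mulVec_add, Matrix.mulVec_smul]; abel
    rw [this, hQ, hA, empNorm_sq, empNorm_sq]
    simp only [Pi.sub_apply, Pi.smul_apply, smul_eq_mul, sub_sq, mul_pow,
      Finset.sum_add_distrib, Finset.sum_sub_distrib, ← Finset.mul_sum]
    have : ∑ k, 2 * e k * (c * X.mulVec u k) = 2 * c * ∑ k, e k * X.mulVec u k := by
      rw [Finset.mul_sum]; exact Finset.sum_congr rfl fun k _ => by ring
    rw [this]; ring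
  have hb1 : b = β + (1 : ℝ) • u := by rw [one_smul, hu]; abel
  have key : ∀ t : ℝ, 0 < t → t < 1 →
      (1 - t / 2) * Q ≤ A + lam * (penalty G s₀ β - penalty G s₀ b) := by
    intro t ht ht1
    have h1 := hb (β + (1 - t) • u)
    have e1 : β + (1 - t) • u = (1 - t) • b + t • β := by
      rw [hu]; module
    have h2 := penalty_smul_add_smul_le G s₀ (a := 1 - t) (b := t) (by linarith) ht.le b β
    rw [← e1] at h2
    have o : ∀ v, objective X G s₀ lam (X.mulVec β + e) v =
        empNorm (X.mulVec β + e - X.mulVec v) ^ 2 + 2 * lam * penalty G s₀ v := fun _ => rfl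
    rw [o, o, hfit] at h1
    have h3 := hfit 1
    rw [← hb1] at h3
    rw [h3] at h1
    have h4 := mul_le_mul_of_nonneg_left h2 hlam
    have h5 : t * ((1 - t / 2) * Q) ≤ t * (A + lam * (penalty G s₀ β - penalty G s₀ b)) := by
      nlinarith
    exact le_of_mul_le_mul_left h5 ht
  have lim : Filter.Tendsto (fun t : ℝ => (1 - t / 2) * Q) (nhdsWithin 0 (Set.Ioi 0)) (nhds Q) := by
    have : Continuous fun t : ℝ => (1 - t / 2) * Q := by fun_prop
    have h := this.tendsto 0
    simp only [zero_div, sub_zero, one_mul] at h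
    exact h.mono_left nhdsWithin_le_nhds
  refine le_of_tendsto lim ?_
  filter_upwards [Ioo_mem_nhdsGT (zero_lt_one' ℝ)] with t ht
  exact key t ht.1 ht.2

theorem ssgreConst_mul_l2norm_le {c₀ : ℝ} {u : Fin p → ℝ}
    (hu : penalty G s₀ u ≤ (2 + c₀) * √((s : ℝ) * s₀) * l2norm u) :
    ssgreConst X G s s₀ c₀ * l2norm u ≤ empNorm (X.mulVec u) := by
  by_cases h0 : l2norm u = 0
  · rw [h0, mul_zero]; exact empNorm_nonneg _
  · have hpos : 0 < l2norm u := (l2norm_nonneg u).lt_of_ne' h0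
    rw [← le_div_iff₀ hpos]
    refine csInf_le ⟨0, ?_⟩ ⟨u, ⟨hu, ?_⟩, rfl⟩
    · rintro _ ⟨v, -, rfl⟩
      exact div_nonneg (empNorm_nonneg _) (l2norm_nonneg v)
    · rintro rfl
      exact h0 (by simp [l2norm])

/-- Here `w` is the estimation error, `V` the prediction error, `h` the penalty of the error and `T`
the penalty drop. The two bounds on `T` serve the cases `h ≤ 2κw` and `h ≥ 2κw`. -/
theorem l2norm_le_of_noise_le {θ γ lam κ ρ w V h T : ℝ} (hθ : 0 < θ) (hγ : 0 < γ) (hγ1 : γ < 1)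
    (hlam : 0 < lam) (hκ : 0 < κ) (hρ : 0 ≤ ρ) (hw : 0 ≤ w) (hV : 0 ≤ V) (hT1 : T ≤ 2 * κ * w)
    (hT2 : T ≤ 4 * κ * w - h)
    (hcone : h ≤ (2 + 2 * (1 + γ) / (1 - γ)) * κ * w → θ * w ≤ V)
    (hVT : V ^ 2 ≤ γ * lam * max (max h (2 * κ * w)) (ρ * V) + lam * T) :
    w ≤ (1 + γ) * κ * lam * max (2 / θ ^ 2) (1 / 2 * (ρ ^ 2 / κ ^ 2)) := by
  have h1γ : 0 < 1 - γ := by linarith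
  have hκw : 0 ≤ κ * w := by positivity
  rcases le_total (ρ * V) (max h (2 * κ * w)) with hc | hc
  · rw [max_eq_left hc] at hVT
    have hmain : V ^ 2 ≤ 2 * (1 + γ) * lam * (κ * w) ∧ (1 - γ) * h ≤ 4 * (κ * w) := by
      rcases le_total h (2 * κ * w) with hh | hh
      · rw [max_eq_right hh] at hVT
        constructor
        · nlinarith [mul_le_mul_of_nonneg_left hT1 hlam.le]
        · nlinarith
      · rw [max_eq_left hh] at hVT
        have h2 := mul_le_mul_of_nonneg_left hT2 hlam.le
        have h3 : V ^ 2 ≤ lam * (4 * (κ * w) - (1 - γ) * h) := by nlinarith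
        constructor
        · have : (1 - γ) * (2 * κ * w) ≤ (1 - γ) * h := by gcongr
          nlinarith
        · have : 0 ≤ lam * (4 * (κ * w) - (1 - γ) * h) := (sq_nonneg V).trans h3
          have := nonneg_of_mul_nonneg_right this hlam
          linarith
    -- The cone aperture is `2 + 2(1 + γ)/(1 - γ) = 4/(1 - γ)`, exactly what nonnegativity of `4κw -
    -- (1 - γ)h` provides.
    have hθw := hcone (by
      have : 2 + 2 * (1 + γ) / (1 - γ) = 4 / (1 - γ) := by field_simp; ring
      rw [this, mul_assoc, div_mul_eq_mul_div, le_div_iff₀ h1γ]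
      linarith [hmain.2])
    have h4 : (θ * w) ^ 2 ≤ 2 * (1 + γ) * lam * (κ * w) :=
      (pow_le_pow_left₀ (by positivity) hθw 2).trans hmain.1
    have h5 : w ≤ (1 + γ) * κ * lam * (2 / θ ^ 2) := by
      rcases hw.eq_or_lt with h0 | h0
      · rw [← h0]; positivity
      · rw [mul_div_assoc', le_div_iff₀ (by positivity)]
        have : w * (w * θ ^ 2) ≤ w * ((1 + γ) * κ * lam * 2) := by nlinarith
        exact le_of_mul_le_mul_left this h0
    refine h5.trans ?_
    gcongr
    exact le_max_left _ _
  · rw [max_eq_right hc] at hVT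
    -- The prediction term bounds `w` and `T` at once; cancelling one factor `V` needs no restricted
    -- eigenvalue.
    have hwV : 2 * κ * w ≤ ρ * V := (le_max_right _ _).trans hc
    have h1 : V * V ≤ V * ((1 + γ) * lam * ρ) := by nlinarith [hT1.trans hwV]
    have h2 : V ≤ (1 + γ) * lam * ρ := by
      rcases hV.eq_or_lt with h0 | h0
      · rw [← h0]; positivity
      · exact le_of_mul_le_mul_left h1 h0
    have h3 : w ≤ (1 + γ) * κ * lam * (1 / 2 * (ρ ^ 2 / κ ^ 2)) := by
      have e : (1 + γ) * κ * lam * (1 / 2 * (ρ ^ 2 / κ ^ 2)) =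
          ρ * ((1 + γ) * lam * ρ) / (2 * κ) := by field_simp
      rw [e, le_div_iff₀ (by positivity)]
      nlinarith [mul_le_mul_of_nonneg_left h2 hρ]
    refine h3.trans ?_
    gcongr
    exact le_max_right _ _

theorem IsSolution.l2norm_sub_le (hs : 1 ≤ s) (hs₀ : 1 ≤ s₀) (hG : IsGrouping G d)
    {γ lam ρ : ℝ} (hγ : 0 < γ) (hγ1 : γ < 1) (hlam : 0 < lam) (hρ : 0 ≤ ρ)
    (hθ : 0 < ssgreConst X G s s₀ (2 * (1 + γ) / (1 - γ)))
    {β b : Fin p → ℝ} {e : Fin n → ℝ} (hβ : IsDoubleSparse G s s₀ β)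
    (hb : IsSolution X G s₀ lam (X.mulVec β + e) b)
    (he : 1 / n * ∑ k, e k * X.mulVec (b - β) k ≤ γ * lam *
      max (penaltyMax G s s₀ (b - β)) (ρ * empNorm (X.mulVec (b - β)))) :
    l2norm (b - β) ≤ (1 + γ) * √((s : ℝ) * s₀) * lam *
      max (2 / ssgreConst X G s s₀ (2 * (1 + γ) / (1 - γ)) ^ 2)
        (1 / 2 * (ρ ^ 2 / ((s : ℝ) * s₀))) := by
  have hs' : (0 : ℝ) < s := by exact_mod_cast hs
  have hs₀' : (0 : ℝ) < s₀ := by exact_mod_cast hs₀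
  have hT := hβ.penalty_sub_le hG b
  have := l2norm_le_of_noise_le hθ hγ hγ1 hlam (κ := √((s : ℝ) * s₀)) (by positivity) hρ
    (l2norm_nonneg (b - β)) (empNorm_nonneg (X.mulVec (b - β))) hT.1 hT.2
    ssgreConst_mul_l2norm_le ((hb.empNorm_sq_le hlam.le).trans (add_le_add_left he _))
  rwa [Real.sq_sqrt (by positivity)] at this

theorem continuous_objective (X : Matrix (Fin n) (Fin p) ℝ) (G : Fin m → Finset (Fin p)) (s₀ : ℕ)
    (lam : ℝ) (y : Fin n → ℝ) : Continuous (objective X G s₀ lam y) := by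
  have h : Continuous fun β : Fin p → ℝ => X.mulVec β := Continuous.matrix_mulVec continuous_const
    continuous_id
  change Continuous fun β => objective X G s₀ lam y β
  simp only [objective, empNorm, l1norm, groupNorm, l2norm_eq_sqrt, Pi.sub_apply]
  fun_prop

theorem exists_isSolution (X : Matrix (Fin n) (Fin p) ℝ) (G : Fin m → Finset (Fin p)) (s₀ : ℕ)
    {lam : ℝ} (hlam : 0 < lam) (y : Fin n → ℝ) : ∃ b, IsSolution X G s₀ lam y b := by
  refine (continuous_objective X G s₀ lam y).exists_forall_le ?_
  refine Filter.tendsto_atTop_mono (f := fun β : Fin p → ℝ => 2 * lam * ‖β‖) (fun β => ?_)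
    ((tendsto_norm_cocompact_atTop).const_mul_atTop (by positivity))
  -- The penalty alone is coercive, so a minimizer exists whatever the design.
  have h1 : ‖β‖ ≤ penalty G s₀ β := by
    refine le_trans ?_ (l1norm_le_penalty G s₀ β)
    refine (pi_norm_le_iff_of_nonneg (l1norm_nonneg β)).2 fun i => ?_
    exact Finset.single_le_sum (f := fun i => |β i|) (fun _ _ => abs_nonneg _) (Finset.mem_univ i)
  have h2 := mul_le_mul_of_nonneg_left h1 (by positivity : 0 ≤ 2 * lam)
  exact h2.trans (le_add_of_nonneg_left (sq_nonneg _))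

end Deterministic

/-! ### Transfer to the noise and explicit rate -/

section Probability

theorem tuning_pos {γ σ : ℝ} {n m d s s₀ : ℕ} (hn : 1 ≤ n) (hs : 1 ≤ s) (hsm : s ≤ m)
    (hs₀ : 1 ≤ s₀) (hs₀d : s₀ ≤ d) (hσ : 0 < σ) (hγ : 0 < γ) : 0 < tuning γ σ n m d s s₀ := by
  have hn' : (0 : ℝ) < n := by exact_mod_cast hn
  have := logRate_pos hs hsm hs₀ hs₀d
  unfold logRate at this
  unfold tuning
  positivity

theorem log_inv_deltaOf_tuning {γ σ : ℝ} {n m d s s₀ : ℕ} (hn : 1 ≤ n) (hs : 1 ≤ s) (hsm : s ≤ m)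
    (hs₀ : 1 ≤ s₀) (hs₀d : s₀ ≤ d) (hσ : 0 < σ) (hγ : 0 < γ) :
    Real.log (1 / deltaOf γ σ n (tuning γ σ n m d s s₀)) = logRate m d s s₀ := by
  have hn' : (0 : ℝ) < √(n : ℝ) := Real.sqrt_pos.2 (by exact_mod_cast hn)
  have h4 : (0 : ℝ) < 4 + √2 := by positivity
  rw [deltaOf, one_div, Real.log_inv, Real.log_exp, neg_neg,
    show γ * tuning γ σ n m d s s₀ * √(n : ℝ) / ((4 + √2) * σ) = √(logRate m d s s₀) by
      unfold tuning logRate; field_simp, Real.sq_sqrt (logRate_pos hs hsm hs₀ hs₀d).le]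

/-- The noise is only almost everywhere measurable, so a preimage is null-measurable; a measurable
subset of equal measure replaces it. -/
theorem exists_measurableSet_of_map_eq {Ω E : Type*} [MeasurableSpace Ω] [MeasurableSpace E]
    {μ : Measure Ω} {ν : Measure E} {f : Ω → E} (hf : AEMeasurable f μ) (hμ : μ.map f = ν)
    {B : Set E} (hB : MeasurableSet B) :
    ∃ A, MeasurableSet A ∧ μ.real A = ν.real B ∧ ∀ ω ∈ A, f ω ∈ B := by
  obtain ⟨A, hAB, hA, hAe⟩ := (hf.nullMeasurableSet_preimage hB).exists_measurable_subset_ae_eq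
  refine ⟨A, hA, ?_, fun ω hω => hAB hω⟩
  rw [measureReal_congr hAe, ← hμ, measureReal_def, measureReal_def,
    Measure.map_apply_of_aemeasurable hf hB]

theorem map_div_eq_pi_gaussianReal {Ω : Type*} [MeasurableSpace Ω] {μ : Measure Ω}
    [IsProbabilityMeasure μ] {n : ℕ} {σ : ℝ} (hσ : 0 < σ) {ξ : Fin n → Ω → ℝ}
    (hξ : ∀ i, HasLaw (ξ i) (gaussianReal 0 (σ ^ 2).toNNReal) μ) (hξi : iIndepFun ξ μ) :
    μ.map (fun ω i => ξ i ω / σ) = Measure.pi fun _ : Fin n => gaussianReal 0 1 := by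
  have hlaw : ∀ i, HasLaw (fun ω => ξ i ω / σ) (gaussianReal 0 1) μ := fun i => by
    have h := gaussianReal_div_const (hξ i) σ
    have e : (σ ^ 2).toNNReal / NNReal.mk (σ ^ 2) (sq_nonneg σ) = 1 := by
      rw [Real.toNNReal_of_nonneg (sq_nonneg σ)]
      refine div_self fun h0 => ?_
      exact (pow_pos hσ 2).ne' (congrArg NNReal.toReal h0)
    rw [zero_div] at h
    convert h
    exact e.symm
  have hind : iIndepFun (fun i ω => ξ i ω / σ) μ :=
    hξi.comp (fun _ x => x / σ) fun _ => by fun_prop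
  rw [(iIndepFun_iff_map_fun_eq_pi_map fun i => (hlaw i).aemeasurable).1 hind]
  simp_rw [(hlaw _).map_eq]

variable {n p m d s s₀ : ℕ} {X : Matrix (Fin n) (Fin p) ℝ} {G : Fin m → Finset (Fin p)}

theorem exists_event_error_le {Ω : Type*} [MeasurableSpace Ω] (μ : Measure Ω)
    [IsProbabilityMeasure μ] (hn : 1 ≤ n) (hs : 1 ≤ s) (hsm : s ≤ m) (hs₀ : 1 ≤ s₀)
    (hs₀d : s₀ ≤ d) (hG : IsGrouping G d) (hX : SparseGroupNormalized X G s₀)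
    {σ γ : ℝ} (hσ : 0 < σ) (hγ : 0 < γ) (hγ1 : γ < 1)
    (hθ : 0 < ssgreConst X G s s₀ (2 * (1 + γ) / (1 - γ)))
    {β : Fin p → ℝ} (hβ : IsDoubleSparse G s s₀ β) {ξ : Fin n → Ω → ℝ}
    (hξ : ∀ i, HasLaw (ξ i) (gaussianReal 0 (σ ^ 2).toNNReal) μ) (hξi : iIndepFun ξ μ)
    {δ₀ : ℝ} (hδ : 0 < δ₀) (hδ1 : δ₀ < 1) :
    ∃ A : Set Ω, MeasurableSet A ∧ 1 - δ₀ / 2 ≤ μ.real A ∧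
      ∀ ω ∈ A, ∀ b, IsSolution X G s₀ (tuning γ σ n m d s s₀)
          (X.mulVec β + fun i => ξ i ω) b →
        l2norm (b - β) ≤ (1 + γ) * √((s : ℝ) * s₀) * tuning γ σ n m d s s₀ *
          max (2 / ssgreConst X G s s₀ (2 * (1 + γ) / (1 - γ)) ^ 2)
            (1 / 2 * (Real.log (1 / δ₀) / (logRate m d s s₀ * ((s : ℝ) * s₀)))) := by
  have hL := logRate_pos hs hsm hs₀ hs₀d
  have hn' : (0 : ℝ) < n := by exact_mod_cast hn
  have hlog : 0 ≤ Real.log (1 / δ₀) := Real.log_nonneg (by rw [le_div_iff₀ hδ]; linarith)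
  have hae : AEMeasurable (fun ω i => ξ i ω / σ) μ :=
    aemeasurable_pi_lambda _ fun i => (hξ i).aemeasurable.div_const σ
  obtain ⟨A, hA, hAB, hAmem⟩ := exists_measurableSet_of_map_eq hae
    (map_div_eq_pi_gaussianReal hσ hξ hξi)
    (measurableSet_setOf_score_le X _ :
      MeasurableSet (scoreBoundSet X G d s s₀ √(Real.log (1 / δ₀))))
  refine ⟨A, hA, hAB ▸ one_sub_le_measureReal_scoreBoundSet hn hs hsm hs₀ hs₀d hG hX hδ,
    fun ω hω b hb => ?_⟩
  have key := hb.l2norm_sub_le hs hs₀ hG hγ hγ1 (tuning_pos hn hs hsm hs₀ hs₀d hσ hγ)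
    (ρ := √(Real.log (1 / δ₀)) / √(logRate m d s s₀)) (by positivity) hθ hβ ?_
  · rwa [div_pow, Real.sq_sqrt hlog, Real.sq_sqrt hL.le, div_div] at key
  · have h1 := hAmem ω hω (b - β)
    rw [sum_score_mul] at h1
    -- The tuning parameter is calibrated so that `γλ` is the noise scale times `(4 + √2)√L`;
    -- factoring `√L` out of the maximum explains the quotient in `ρ`.
    have hlam : γ * tuning γ σ n m d s s₀ = (4 + √2) * σ / √(n : ℝ) * √(logRate m d s s₀) := by
      unfold tuning logRate; field_simp
    have e1 : 1 / (n : ℝ) * ∑ k, ξ k ω * X.mulVec (b - β) k =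
        σ / √(n : ℝ) * ((∑ k, ξ k ω / σ * X.mulVec (b - β) k) / √(n : ℝ)) := by
      rw [div_mul_div_comm, Real.mul_self_sqrt hn'.le, Finset.mul_sum, Finset.mul_sum,
        Finset.sum_div]
      exact Finset.sum_congr rfl fun k _ => by field_simp
    rw [e1, hlam, mul_assoc _ √(logRate m d s s₀), mul_max_of_nonneg _ _ (Real.sqrt_nonneg _),
      ← mul_assoc √(logRate m d s s₀) (_ / _), mul_div_cancel₀ _ (Real.sqrt_pos.2 hL).ne']
    refine (mul_le_mul_of_nonneg_left h1 (by positivity)).trans (le_of_eq ?_)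
    ring

theorem rate_constant_le : (4 + √2) ^ 2 * (2 + 4 * Real.log 2) ≤ 144 := by
  have h2 : √2 ^ 2 = 2 := Real.sq_sqrt zero_le_two
  have h3 : √2 ≤ 1.42 := Real.sqrt_le_iff.2 (by norm_num)
  have h4 := Real.log_two_lt_d9
  have h5 := Real.log_nonneg one_le_two
  have h6 : (4 + √2) ^ 2 ≤ 29.36 := by nlinarith
  nlinarith

theorem sqrt_mul_tuning_le {γ σ : ℝ} (hn : 1 ≤ n) (hs : 1 ≤ s) (hsm : s ≤ m)
    (hs₀ : 1 ≤ s₀) (hs₀d : s₀ ≤ d) (hσ : 0 < σ) (hγ : 0 < γ) :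
    √((s : ℝ) * s₀) * tuning γ σ n m d s s₀ ≤
      12 / γ * (σ * √((s : ℝ) * s₀ * Real.log (Real.exp 1 * d / s₀) +
            s * Real.log (Real.exp 1 * m / s)) / √(n : ℝ)) := by
  have hs' : (0 : ℝ) < s := by exact_mod_cast hs
  have hs₀' : (0 : ℝ) < s₀ := by exact_mod_cast hs₀
  have hsm' : (s : ℝ) ≤ m := by exact_mod_cast hsm
  have hs₀d' : (s₀ : ℝ) ≤ d := by exact_mod_cast hs₀d
  have hm' := hs'.trans_le hsm'
  have hd' := hs₀'.trans_le hs₀d'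
  have hn' : (0 : ℝ) < √(n : ℝ) := Real.sqrt_pos.2 (by exact_mod_cast hn)
  have he := Real.exp_pos 1
  have one_le : ∀ {a b : ℝ}, 0 < a → a ≤ b → 1 ≤ Real.log (Real.exp 1 * b / a) := by
    intro a b ha hab
    rw [Real.le_log_iff_exp_le (by have := ha.trans_le hab; positivity), le_div_iff₀ ha]
    gcongr
  have ha := one_le hs₀' hs₀d'
  have hb := one_le hs' hsm'
  set a := Real.log (Real.exp 1 * d / s₀) with had
  set b := Real.log (Real.exp 1 * m / s) with hbd
  have e1 : Real.log (2 * Real.exp 1 * d / s₀) = Real.log 2 + a := by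
    rw [had, ← Real.log_mul two_ne_zero (by positivity)]; congr 1; ring
  have e2 : Real.log (4 * Real.exp 1 * m / s) = 2 * Real.log 2 + b := by
    have : 2 * Real.log 2 = Real.log 4 := by
      rw [show (4 : ℝ) = 2 ^ 2 by norm_num, Real.log_pow]; norm_num
    rw [this, hbd, ← Real.log_mul four_ne_zero (by positivity)]; congr 1; ring
  have hl2 := Real.log_nonneg one_le_two
  have hsq : (4 + √2) * √((s : ℝ) * s₀ * logRate m d s s₀) ≤ 12 * √((s : ℝ) * s₀ * a + s * b) := by
    -- Both logarithms `a` and `b` are at least `1`, so the `log 2` terms can be absorbed. The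
    -- coefficient `2 + 4 log 2` is the one needed for `b`.
    have hR : (s : ℝ) * s₀ * logRate m d s s₀ ≤
        (2 + 4 * Real.log 2) * ((s : ℝ) * s₀ * a + s * b) := by
      unfold logRate
      rw [e1, e2]
      have e3 : (s : ℝ) * s₀ * (Real.log 2 + a + 2 / s₀ * (2 * Real.log 2 + b)) =
          (s : ℝ) * s₀ * (Real.log 2 + a) + s * (2 * (2 * Real.log 2 + b)) := by field_simp
      rw [e3]
      have h1 : Real.log 2 + a ≤ (2 + 4 * Real.log 2) * a := by nlinarith
      have h2 : 2 * (2 * Real.log 2 + b) ≤ (2 + 4 * Real.log 2) * b := by nlinarith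
      have h3 := mul_le_mul_of_nonneg_left h1 (by positivity : 0 ≤ (s : ℝ) * s₀)
      have h4 := mul_le_mul_of_nonneg_left h2 hs'.le
      linarith
    have hq : 0 ≤ (s : ℝ) * s₀ * a + s * b := by positivity
    refine abs_le_of_sq_le_sq' ?_ (by positivity) |>.2
    rw [mul_pow, mul_pow, Real.sq_sqrt hq, Real.sq_sqrt
      (mul_nonneg (by positivity) (logRate_pos hs hsm hs₀ hs₀d).le)]
    calc _ ≤ (4 + √2) ^ 2 * ((2 + 4 * Real.log 2) * ((s : ℝ) * s₀ * a + s * b)) := by gcongr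
      _ = ((4 + √2) ^ 2 * (2 + 4 * Real.log 2)) * ((s : ℝ) * s₀ * a + s * b) := by ring
      _ ≤ 144 * ((s : ℝ) * s₀ * a + s * b) := by gcongr; exact rate_constant_le
      _ = _ := by norm_num
  calc √((s : ℝ) * s₀) * tuning γ σ n m d s s₀
      = σ / (γ * √(n : ℝ)) * ((4 + √2) * √((s : ℝ) * s₀ * logRate m d s s₀)) := by
        rw [Real.sqrt_mul (by positivity : 0 ≤ (s : ℝ) * s₀)]
        unfold tuning logRate
        ring
    _ ≤ σ / (γ * √(n : ℝ)) * (12 * √((s : ℝ) * s₀ * a + s * b)) := by gcongr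
    _ = _ := by field_simp

end Probability

end SGLasso

open SGLasso
theorem mainTheorem1
    {Ω : Type*} [MeasurableSpace Ω] (μ : Measure Ω) [IsProbabilityMeasure μ]
    (n p m d s s₀ : ℕ) (hn : 1 ≤ n) (hs : 1 ≤ s) (hsm : s ≤ m) (hs₀ : 1 ≤ s₀) (hs₀d : s₀ ≤ d)
    (G : Fin m → Finset (Fin p)) (hG : IsGrouping G d)
    (X : Matrix (Fin n) (Fin p) ℝ) (hX : SparseGroupNormalized X G s₀)
    (σ γ : ℝ) (hσ : 0 < σ) (hγ : 0 < γ) (hγ1 : γ < 1)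
    (hθ : 0 < ssgreConst X G s s₀ (2 * (1 + γ) / (1 - γ)))
    (βs : Fin p → ℝ) (hβs : IsDoubleSparse G s s₀ βs)
    (ξ : Fin n → Ω → ℝ) (hξ : ∀ i, HasLaw (ξ i) (gaussianReal 0 (σ ^ 2).toNNReal) μ)
    (hξi : iIndepFun ξ μ) :
    -- the estimator exists for every realization of the noise
    (∀ ω, ∃ b, IsSolution X G s₀ (tuning γ σ n m d s s₀)
      (X.mulVec βs + fun i => ξ i ω) b) ∧
    -- the error bound, with probability at least `1 - δ₀ / 2`
    (∀ δ₀ : ℝ, 0 < δ₀ → δ₀ < 1 → ∃ A : Set Ω, MeasurableSet A ∧ 1 - δ₀ / 2 ≤ μ.real A ∧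
      ∀ ω ∈ A, ∀ b, IsSolution X G s₀ (tuning γ σ n m d s s₀)
          (X.mulVec βs + fun i => ξ i ω) b →
        l2norm (b - βs) ≤ (1 + γ) * √((s : ℝ) * s₀) * tuning γ σ n m d s s₀ *
          max (2 / ssgreConst X G s s₀ (2 * (1 + γ) / (1 - γ)) ^ 2)
            (1 / 2 * (Real.log (1 / δ₀) /
              (Real.log (1 / deltaOf γ σ n (tuning γ σ n m d s s₀)) * ((s : ℝ) * s₀))))) ∧
    -- the resulting rate, with exponentially high probability
    (∀ C : ℝ, 0 < C → ∃ A : Set Ω, MeasurableSet A ∧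
      1 - Real.exp (-(C * ((s : ℝ) * s₀ * Real.log (2 * Real.exp 1 * d / s₀) +
          2 * s * Real.log (4 * Real.exp 1 * m / s)))) / 2 ≤ μ.real A ∧
      ∀ ω ∈ A, ∀ b, IsSolution X G s₀ (tuning γ σ n m d s s₀)
          (X.mulVec βs + fun i => ξ i ω) b →
        l2norm (b - βs) ≤ 12 * ((1 + γ) / γ) *
          max (2 / ssgreConst X G s s₀ (2 * (1 + γ) / (1 - γ)) ^ 2) (C / 2) *
          (σ * √((s : ℝ) * s₀ * Real.log (Real.exp 1 * d / s₀) +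
            s * Real.log (Real.exp 1 * m / s)) / √(n : ℝ))) := by
  have hΛ := log_inv_deltaOf_tuning (m := m) (d := d) hn hs hsm hs₀ hs₀d hσ hγ
  have hL := logRate_pos hs hsm hs₀ hs₀d
  have hs' : (0 : ℝ) < s := by exact_mod_cast hs
  have hs₀' : (0 : ℝ) < s₀ := by exact_mod_cast hs₀
  refine ⟨fun ω => exists_isSolution X G s₀ (tuning_pos hn hs hsm hs₀ hs₀d hσ hγ) _,
    fun δ₀ hδ hδ1 => ?_, fun C hC => ?_⟩
  · rw [hΛ]
    exact exists_event_error_le μ hn hs hsm hs₀ hs₀d hG hX hσ hγ hγ1 hθ hβs hξ hξi hδ hδ1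
  · have hexp : (s : ℝ) * s₀ * Real.log (2 * Real.exp 1 * d / s₀) +
        2 * s * Real.log (4 * Real.exp 1 * m / s) = logRate m d s s₀ * ((s : ℝ) * s₀) := by
      unfold logRate
      field_simp
    rw [hexp]
    -- With `δ₀ = exp (-C L s s₀)` the confidence ratio is exactly `C`.
    obtain ⟨A, hA, hAp, hAb⟩ := exists_event_error_le μ hn hs hsm hs₀ hs₀d hG hX hσ hγ hγ1 hθ hβs
      hξ hξi (Real.exp_pos (-(C * (logRate m d s s₀ * ((s : ℝ) * s₀)))))
      (by rw [Real.exp_lt_one_iff, neg_lt_zero]; positivity)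
    refine ⟨A, hA, hAp, fun ω hω b hb => (hAb ω hω b hb).trans ?_⟩
    rw [one_div (Real.exp _), Real.log_inv, Real.log_exp, neg_neg,
      mul_div_cancel_right₀ C (by positivity), one_div_mul_eq_div, mul_assoc (1 + γ)]
    have hrate := sqrt_mul_tuning_le (m := m) (d := d) hn hs hsm hs₀ hs₀d hσ hγ
    refine (mul_le_mul_of_nonneg_right (mul_le_mul_of_nonneg_left hrate (by positivity))
      (by positivity)).trans (le_of_eq ?_)
    ring
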